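/- Let $E$ be a smooth manifold of dimension $n+m$ and $M$ a smooth manifold of dimension $n$ (both Hausdorff and second countable), and let $\Gamma$ and $\Theta$ be smooth torsion-free linear connections on $TE\to E$ and $TM\to M$. *Jets of submanifolds.* Let $\pi_{1,0}\colon J^1(E,n)\to E$ be the bundle of first jets $\theta=[L]^1_p$ of $n$-dimensional submanifolds $L\subset E$, identified with the Grassmann bundle of $n$-planes $R_\theta=T_pL\subset T_pE$. Over $J^1(E,n)$ put $T^{1,0}=\pi_{1,0}^*(TE)$, $H^{1,0}=\{(\theta,v): v\in R_\theta\}\subset T^{1,0}$, $V^{1,0}=T^{1,0}/H^{1,0}$, let $\omega^1\colon T^{1,0}\to V^{1,0}$ be the quotient map, and let $D^1$ be the section of $(H^{1,0})^*\otimes T^{1,0}$ given by the inclusion $H^{1,0}\hookrightarrow T^{1,0}$. Identify $\ker T\pi_{1,0}\simeq (H^{1,0})^*\otimes V^{1,0}$ by sending the velocity $\gamma'(0)$ of a curve $\gamma$ in a fibre of $\pi_{1,0}$ to $(\mathrm{id}\otimes\omega^1)\left(\frac{d}{dt}\big|_{t=0}D^1(\gamma(t))\right)$. The connection $\dot\Gamma$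 on $\pi_{1,0}$ is the one with vertical projection $$\upsilon_{\dot\Gamma}=(\mathrm{id}\otimes\omega^1)\circ\upsilon_{\Omega}\circ TD^1\colon TJ^1(E,n)\to\ker T\pi_{1,0},\qquad \Omega=\Xi^*\otimes\pi_{1,0}^*(\Gamma),$$ where $\Xi$ is an arbitrary smooth linear connection on $H^{1,0}$, $\Xi^*$ is its dual, and $\upsilon_\Omega$ is the vertical projection of the linear connection $\Omega$ on $(H^{1,0})^*\otimes T^{1,0}$. *Parametrized jets.* Let $\mathrm{pr}_M,\mathrm{pr}_E$ be the projections of $M\times E$, and let $J^1\mathrm{pr}_M=\mathrm{pr}_E^*(TE)\otimes\mathrm{pr}_M^*(T^*M)$ be the bundle over $M\times E$ of first jets $[s]^1_x$ of local maps $s\colon M\to E$, regarded as sections of $\mathrm{pr}_M$ and identified with the linear maps $T_xs\colon T_xM\to T_{s(x)}E$; write $\mathrm{pr}_{M\,1,0}\colon J^1\mathrm{pr}_M\to M\times E$ for its projection. Let $\dot\Gamma_{\mathrm{pr}_M}=\mathrm{pr}_E^*(\Gamma)\otimes\mathrm{pr}_M^*(\Theta^*)$, a linear connection on $\mathrm{pr}_{M\,1,0}$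 with vertical projection $\upsilon_{\dot\Gamma_{\mathrm{pr}_M}}\colon TJ^1\mathrm{pr}_M\to\ker T\mathrm{pr}_{M\,1,0}$. Let $\mathrm{Imm}\,J^1\mathrm{pr}_M$ be the open set of jets of immersions, and let $$\mathrm{pr}_E^{(1)}\colon \mathrm{Imm}\,J^1\mathrm{pr}_M\to J^1(E,n),\qquad [s]^1_x\mapsto[\mathrm{im}\,s]^1_{s(x)},$$ that is, $\mathrm{pr}_E^{(1)}$ sends a linear map $T_xM\to T_pE$ to its image. **Theorem.** The map $\mathrm{pr}_E^{(1)}$ is smooth on $\mathrm{Imm}\,J^1\mathrm{pr}_M$ and, for every choice of $\Xi$, $$T\mathrm{pr}_E^{(1)}\circ\upsilon_{\dot\Gamma_{\mathrm{pr}_M}}=\upsilon_{\dot\Gamma}\circ T\mathrm{pr}_E^{(1)}\qquad\text{on } T(\mathrm{Imm}\,J^1\mathrm{pr}_M).$$ In this sense $\dot\Gamma$ is the quotient connection of $\dot\Gamma_{\mathrm{pr}_M}$ via $\mathrm{pr}_E^{(1)}$. -/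

import Mathlib

open Set Bundle Topology Manifold
open scoped ContDiff

noncomputable section

/-- The model space `ℝ^d`. -/
abbrev Rn (d : ℕ) : Type := EuclideanSpace ℝ (Fin d)

/-! ### The space of 1-jets of `n`-dimensional submanifolds (Grassmann bundle) -/

section JetSpace

variable (n m : ℕ) (E : Type*) [TopologicalSpace E] [ChartedSpace (Rn (n + m)) E]

/-- The space `J¹(E,n)` of first jets of `n`-dimensional submanifolds of an `(n+m)`-dimensional
manifold `E`: the jet `[L]¹_p` is identified with the tangent plane `T_p L`, so that a point is a
pair `(p, W)` with `W` an `n`-dimensional subspace of `T_p E`. -/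
structure JetSub where
  pt : E
  plane : Submodule ℝ (TangentSpace 𝓘(ℝ, Rn (n + m)) pt)
  finrank_plane : Module.finrank ℝ plane = n

/-- A divided chart `(u^λ, u^i)` of `E`: a chart of the atlas followed by a linear splitting of
`ℝ^(n+m)` into `ℝ^n × ℝ^m`. -/
structure DividedChart where
  chart : OpenPartialHomeomorph E (Rn (n + m))
  mem : chart ∈ atlas (Rn (n + m)) E
  split : Rn (n + m) ≃L[ℝ] Rn n × Rn m

variable {n m E}

/-- The coordinates of a point in a divided chart. -/
def DividedChart.coord (c : DividedChart n m E) (p : E) : Rn n × Rn m := c.split (c.chart p)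

/-- The differential at `p` of a divided chart. -/
def DividedChart.diff (c : DividedChart n m E) (p : E) :
    TangentSpace 𝓘(ℝ, Rn (n + m)) p →L[ℝ] Rn n × Rn m :=
  (c.split : Rn (n + m) →L[ℝ] Rn n × Rn m) ∘L
    (mfderiv 𝓘(ℝ, Rn (n + m)) 𝓘(ℝ, Rn (n + m)) c.chart p :
      TangentSpace 𝓘(ℝ, Rn (n + m)) p →L[ℝ] Rn (n + m))

theorem exists_splitting (W : Submodule ℝ (Rn (n + m))) (hW : Module.finrank ℝ W = n) :
    ∃ L : Rn (n + m) ≃L[ℝ] Rn n × Rn m,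
      W.map (L : Rn (n + m) →ₗ[ℝ] Rn n × Rn m) = (0 : Rn n →ₗ[ℝ] Rn m).graph := by
  obtain ⟨K, hK⟩ := W.exists_isCompl
  have hsum := Submodule.finrank_add_eq_of_isCompl hK
  have hKm : Module.finrank ℝ K = m := by
    rw [hW] at hsum; simp at hsum; exact hsum
  have e1 : W ≃ₗ[ℝ] Rn n := LinearEquiv.ofFinrankEq _ _ (by simp [hW])
  have e2 : K ≃ₗ[ℝ] Rn m := LinearEquiv.ofFinrankEq _ _ (by simp [hKm])
  let L := ((Submodule.prodEquivOfIsCompl W K hK).symm.trans (e1.prodCongr e2))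
  have hL : ∀ x : W, L x = (e1 x, 0) := by
    intro x
    simp [L]
  refine ⟨L.toContinuousLinearEquiv, ?_⟩
  ext ⟨a, b⟩
  simp only [Submodule.mem_map, LinearMap.mem_graph_iff, LinearMap.zero_apply]
  constructor
  · rintro ⟨x, hx, hxe⟩
    have h2 : L x = (a, b) := hxe
    have := hL ⟨x, hx⟩
    simp only at this
    rw [h2] at this
    exact (Prod.ext_iff.1 this).2
  · rintro rfl
    refine ⟨(e1.symm a : W), (e1.symm a).2, ?_⟩
    have := hL (e1.symm a)
    simpa using! this

theorem exists_plane (p : E) : ∃ W : Submodule ℝ (TangentSpace 𝓘(ℝ, Rn (n + m)) p),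
    Module.finrank ℝ W = n := by
  have hdim : Module.finrank ℝ (Rn n × Rn m) = Module.finrank ℝ (Rn (n + m)) := by
    rw [Module.finrank_prod]; simp
  let e : (Rn n × Rn m) ≃ₗ[ℝ] Rn (n + m) := LinearEquiv.ofFinrankEq _ _ hdim
  have hf : Function.Injective (e.toLinearMap ∘ₗ LinearMap.inl ℝ (Rn n) (Rn m)) :=
    e.injective.comp LinearMap.inl_injective
  exact ⟨LinearMap.range _, (LinearMap.finrank_range_of_inj hf).trans (finrank_euclideanSpace_fin (𝕜 := ℝ))⟩

open Classical in
/-- The point `(p, W)` of `J¹(E,n)` given by a subspace `W` of `T_p E`; a subspace of the wrong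
dimension is replaced by an arbitrary one. -/
def JetSub.ofSubmodule (p : E) (W : Submodule ℝ (TangentSpace 𝓘(ℝ, Rn (n + m)) p)) :
    JetSub n m E :=
  if h : Module.finrank ℝ W = n then ⟨p, W, h⟩
  else ⟨p, (exists_plane p).choose, (exists_plane p).choose_spec⟩

/-- The slope of a subspace of `ℝ^n × ℝ^m` that is the graph of a linear map. -/
def graphSlope (S : Submodule ℝ (Rn n × Rn m)) : Rn n →L[ℝ] Rn m :=
  open Classical in
  if h : ∃ A : Rn n →L[ℝ] Rn m, S = (A : Rn n →ₗ[ℝ] Rn m).graph then h.choose else 0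

theorem graph_inj {A B : Rn n →L[ℝ] Rn m}
    (h : (A : Rn n →ₗ[ℝ] Rn m).graph = (B : Rn n →ₗ[ℝ] Rn m).graph) : A = B := by
  ext1 x
  have : (x, A x) ∈ (B : Rn n →ₗ[ℝ] Rn m).graph := by rw [← h]; simp [LinearMap.mem_graph_iff]
  simpa [LinearMap.mem_graph_iff] using this

theorem graphSlope_graph (A : Rn n →L[ℝ] Rn m) : graphSlope (A : Rn n →ₗ[ℝ] Rn m).graph = A := by
  have h : ∃ B : Rn n →L[ℝ] Rn m,
    (A : Rn n →ₗ[ℝ] Rn m).graph = (B : Rn n →ₗ[ℝ] Rn m).graph := ⟨A, rfl⟩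
  rw [graphSlope, dif_pos h]
  exact graph_inj h.choose_spec.symm

/-- The domain of the chart of `J¹(E,n)` induced by a divided chart: the planes that project
isomorphically onto `ℝ^n`, that is, the tangent planes to the submanifolds `u^i = f^i(u^λ)`. -/
def DividedChart.domain (c : DividedChart n m E) : Set (JetSub n m E) :=
  {θ | θ.pt ∈ c.chart.source ∧ ∃ A : Rn n →L[ℝ] Rn m,
    θ.plane.map (c.diff θ.pt : TangentSpace 𝓘(ℝ, Rn (n + m)) θ.pt →ₗ[ℝ] Rn n × Rn m) =
      (A : Rn n →ₗ[ℝ] Rn m).graph}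

/-- The coordinates `(u^i_λ)` of a plane. -/
def DividedChart.jetSlope (c : DividedChart n m E) (θ : JetSub n m E) : Rn n →L[ℝ] Rn m :=
  graphSlope (θ.plane.map
    (c.diff θ.pt : TangentSpace 𝓘(ℝ, Rn (n + m)) θ.pt →ₗ[ℝ] Rn n × Rn m))

theorem DividedChart.map_diff_plane (c : DividedChart n m E) {θ : JetSub n m E}
    (h : θ ∈ c.domain) :
    θ.plane.map (c.diff θ.pt : TangentSpace 𝓘(ℝ, Rn (n + m)) θ.pt →ₗ[ℝ] Rn n × Rn m) =
      (c.jetSlope θ : Rn n →ₗ[ℝ] Rn m).graph := by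
  obtain ⟨-, A, hA⟩ := h
  rw [jetSlope, hA, graphSlope_graph]

variable [IsManifold 𝓘(ℝ, Rn (n + m)) ∞ E]

theorem DividedChart.diff_bijective (c : DividedChart n m E) {p : E} (hp : p ∈ c.chart.source) :
    Function.Bijective (c.diff p) := by
  have h := mdifferentiable_of_mem_atlas (I := 𝓘(ℝ, Rn (n + m))) c.mem
  have := (h.mfderiv hp).bijective
  exact c.split.bijective.comp this

theorem finrank_graph (A : Rn n →L[ℝ] Rn m) :
    Module.finrank ℝ (A : Rn n →ₗ[ℝ] Rn m).graph = n := by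
  rw [LinearMap.graph_eq_range_prod, LinearMap.finrank_range_of_inj]
  · simp
  · intro x y h; exact (Prod.ext_iff.1 h).1

theorem DividedChart.finrank_comap (c : DividedChart n m E) {p : E} (hp : p ∈ c.chart.source)
    (A : Rn n →L[ℝ] Rn m) :
    Module.finrank ℝ ((A : Rn n →ₗ[ℝ] Rn m).graph.comap
      (c.diff p : TangentSpace 𝓘(ℝ, Rn (n + m)) p →ₗ[ℝ] Rn n × Rn m)) = n := by
  have hb := c.diff_bijective hp
  let e := LinearEquiv.ofBijective (c.diff p : TangentSpace 𝓘(ℝ, Rn (n + m)) p →ₗ[ℝ] Rn n × Rn m) hb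
  have := LinearEquiv.finrank_eq (e.submoduleMap ((A : Rn n →ₗ[ℝ] Rn m).graph.comap
      (c.diff p : TangentSpace 𝓘(ℝ, Rn (n + m)) p →ₗ[ℝ] Rn n × Rn m)))
  rw [this]
  have h2 : Submodule.map (e : TangentSpace 𝓘(ℝ, Rn (n + m)) p →ₗ[ℝ] Rn n × Rn m)
    ((A : Rn n →ₗ[ℝ] Rn m).graph.comap
      (c.diff p : TangentSpace 𝓘(ℝ, Rn (n + m)) p →ₗ[ℝ] Rn n × Rn m)) = (A : Rn n →ₗ[ℝ] Rn m).graph :=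
    Submodule.map_comap_eq_of_surjective hb.2 _
  have h3 := finrank_graph A
  rw [← h2] at h3
  exact h3

/-- The chart `(u^λ, u^i, u^i_λ)` of `J¹(E,n)` induced by a divided chart `(u^λ, u^i)`. -/
def DividedChart.jetChart (c : DividedChart n m E) :
    PartialEquiv (JetSub n m E) ((Rn n × Rn m) × (Rn n →L[ℝ] Rn m)) where
  toFun θ := (c.coord θ.pt, c.jetSlope θ)
  invFun z := JetSub.ofSubmodule (c.chart.symm (c.split.symm z.1))
    ((z.2 : Rn n →ₗ[ℝ] Rn m).graph.comap (c.diff (c.chart.symm (c.split.symm z.1)) :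
      TangentSpace 𝓘(ℝ, Rn (n + m)) (c.chart.symm (c.split.symm z.1)) →ₗ[ℝ] Rn n × Rn m))
  source := c.domain
  target := {z | c.split.symm z.1 ∈ c.chart.target}
  map_source' := by
    rintro θ ⟨h, -⟩
    simpa [coord] using c.chart.map_source h
  map_target' := by
    rintro ⟨q, A⟩ h
    have hp := c.chart.map_target h
    rw [JetSub.ofSubmodule, dif_pos (c.finrank_comap hp A)]
    exact ⟨hp, A, Submodule.map_comap_eq_of_surjective (c.diff_bijective hp).2 _⟩
  left_inv' := by
    rintro ⟨p, W, hW⟩ h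
    have hs := c.map_diff_plane h
    obtain ⟨hp, -⟩ := h
    have e : c.chart.symm (c.split.symm (c.coord p)) = p := by
      simpa [coord] using c.chart.left_inv hp
    simp only at hs ⊢
    rw [← hs, e, Submodule.comap_map_eq_of_injective (c.diff_bijective hp).1,
      JetSub.ofSubmodule, dif_pos hW]
  right_inv' := by
    rintro ⟨q, A⟩ h
    have hp := c.chart.map_target h
    simp only
    rw [JetSub.ofSubmodule, dif_pos (c.finrank_comap hp A)]
    ext1
    · simpa [coord] using congrArg c.split (c.chart.right_inv h)
    · exact (congrArg graphSlope (Submodule.map_comap_eq_of_surjective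
        (c.diff_bijective hp).2 _)).trans (graphSlope_graph A)

theorem JetSub.pt_ofSubmodule (p : E)
    (W : Submodule ℝ (TangentSpace 𝓘(ℝ, Rn (n + m)) p)) :
    (JetSub.ofSubmodule (n := n) (m := m) p W).pt = p := by
  unfold JetSub.ofSubmodule; split_ifs <;> rfl

/-- The change of coordinates between two divided charts of `E`. -/
def transitionMap (c c' : DividedChart n m E) (q : Rn n × Rn m) : Rn n × Rn m :=
  c'.coord (c.chart.symm (c.split.symm q))

/-- The set where the change of coordinates between two divided charts of `E` is defined. -/
def transitionSource (c c' : DividedChart n m E) : Set (Rn n × Rn m) :=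
  c.split.symm ⁻¹' (c.chart.symm.trans c'.chart).source

/-- The first block `∂u'^ξ/∂u^λ + u^i_λ ∂u'^ξ/∂u^i` of the total derivative of the change of
coordinates. -/
def transitionFst (c c' : DividedChart n m E) (z : (Rn n × Rn m) × (Rn n →L[ℝ] Rn m)) :
    Rn n →L[ℝ] Rn n :=
  (ContinuousLinearMap.fst ℝ (Rn n) (Rn m)).comp
    ((fderiv ℝ (transitionMap c c') z.1).comp ((ContinuousLinearMap.id ℝ (Rn n)).prod z.2))

/-- The second block of the total derivative of the change of coordinates. -/
def transitionSnd (c c' : DividedChart n m E) (z : (Rn n × Rn m) × (Rn n →L[ℝ] Rn m)) :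
    Rn n →L[ℝ] Rn m :=
  (ContinuousLinearMap.snd ℝ (Rn n) (Rn m)).comp
    ((fderiv ℝ (transitionMap c c') z.1).comp ((ContinuousLinearMap.id ℝ (Rn n)).prod z.2))

theorem isOpen_transitionSource (c c' : DividedChart n m E) : IsOpen (transitionSource c c') :=
  (c.chart.symm.trans c'.chart).open_source.preimage c.split.symm.continuous

theorem contDiffOn_transitionMap (c c' : DividedChart n m E) :
    ContDiffOn ℝ ∞ (transitionMap c c') (transitionSource c c') := by
  have h : ContDiffOn ℝ ∞ (c.chart.symm.trans c'.chart) (c.chart.symm.trans c'.chart).source := by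
    have h1 := (contDiffGroupoid ∞ 𝓘(ℝ, Rn (n + m))).compatible c.mem c'.mem
    have h2 := (contMDiffOn_of_mem_contDiffGroupoid h1)
    exact contMDiffOn_iff_contDiffOn.1 h2
  exact c'.split.contDiff.comp_contDiffOn
    (h.comp c.split.symm.contDiff.contDiffOn (fun q hq => hq))

theorem contDiff_id_prod : ContDiff ℝ ∞ (fun z : (Rn n × Rn m) × (Rn n →L[ℝ] Rn m) =>
    (ContinuousLinearMap.id ℝ (Rn n)).prod z.2) := by
  have h : ContDiff ℝ ∞ (fun z : (Rn n × Rn m) × (Rn n →L[ℝ] Rn m) =>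
      ContinuousLinearMap.inl ℝ (Rn n) (Rn m) +
        (ContinuousLinearMap.inr ℝ (Rn n) (Rn m)).comp z.2) :=
    contDiff_const.add (contDiff_const.clm_comp contDiff_snd)
  convert h using 2 with z
  ext x <;> simp

theorem contDiffOn_transitionFst (c c' : DividedChart n m E) :
    ContDiffOn ℝ ∞ (transitionFst c c') (transitionSource c c' ×ˢ univ) := by
  have h : ContDiffOn ℝ ∞ (fun z : (Rn n × Rn m) × (Rn n →L[ℝ] Rn m) =>
      fderiv ℝ (transitionMap c c') z.1) (transitionSource c c' ×ˢ univ) :=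
    ((contDiffOn_transitionMap c c').fderiv_of_isOpen (isOpen_transitionSource c c')
      (m := ∞) (by simp)).comp contDiffOn_fst (fun z hz => hz.1)
  exact contDiffOn_const.clm_comp (h.clm_comp contDiff_id_prod.contDiffOn)

theorem contDiffOn_transitionSnd (c c' : DividedChart n m E) :
    ContDiffOn ℝ ∞ (transitionSnd c c') (transitionSource c c' ×ˢ univ) := by
  have h : ContDiffOn ℝ ∞ (fun z : (Rn n × Rn m) × (Rn n →L[ℝ] Rn m) =>
      fderiv ℝ (transitionMap c c') z.1) (transitionSource c c' ×ˢ univ) :=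
    ((contDiffOn_transitionMap c c').fderiv_of_isOpen (isOpen_transitionSource c c')
      (m := ∞) (by simp)).comp contDiffOn_fst (fun z hz => hz.1)
  exact contDiffOn_const.clm_comp (h.clm_comp contDiff_id_prod.contDiffOn)

theorem diff_eq_comp (c c' : DividedChart n m E) {p : E} (hp : p ∈ c.chart.source)
    (hp' : p ∈ c'.chart.source) (v : TangentSpace 𝓘(ℝ, Rn (n + m)) p) :
    c'.diff p v = fderiv ℝ (transitionMap c c') (c.coord p) (c.diff p v) := by
  have e : c.chart.symm (c.split.symm (c.coord p)) = p := by
    simpa [DividedChart.coord] using c.chart.left_inv hp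
  have hmem : c.coord p ∈ transitionSource c c' := by
    refine ⟨?_, ?_⟩
    · simpa [DividedChart.coord] using c.chart.map_source hp
    · change c.chart.symm (c.split.symm (c.coord p)) ∈ c'.chart.source
      rwa [e]
  have hd : ∀ d : DividedChart n m E, p ∈ d.chart.source →
      HasMFDerivAt 𝓘(ℝ, Rn (n + m)) 𝓘(ℝ, Rn n × Rn m) d.coord p (d.diff p) := by
    intro d hd
    have h := mdifferentiable_of_mem_atlas (I := 𝓘(ℝ, Rn (n + m))) d.mem
    exact (d.split.hasFDerivAt.hasMFDerivAt).comp p (h.mdifferentiableAt hd).hasMFDerivAt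
  have ht : HasFDerivAt (transitionMap c c') (fderiv ℝ (transitionMap c c') (c.coord p))
      (c.coord p) :=
    (((contDiffOn_transitionMap c c').contDiffAt
      ((isOpen_transitionSource c c').mem_nhds hmem)).differentiableAt (by simp)).hasFDerivAt
  have h1 := ht.hasMFDerivAt.comp p (hd c hp)
  have h2 : HasMFDerivAt 𝓘(ℝ, Rn (n + m)) 𝓘(ℝ, Rn n × Rn m) c'.coord p
      ((fderiv ℝ (transitionMap c c') (c.coord p)).comp (c.diff p)) := by
    refine h1.congr_of_eventuallyEq ?_
    filter_upwards [c.chart.open_source.mem_nhds hp] with x hx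
    simp [transitionMap, DividedChart.coord, c.chart.left_inv hx]
  exact DFunLike.congr_fun (hasMFDerivAt_unique (hd c' hp') h2) v

theorem map_diff_eq_range (c c' : DividedChart n m E) {θ : JetSub n m E} (hθ : θ ∈ c.domain)
    (hp' : θ.pt ∈ c'.chart.source) :
    θ.plane.map (c'.diff θ.pt : TangentSpace 𝓘(ℝ, Rn (n + m)) θ.pt →ₗ[ℝ] Rn n × Rn m) =
      LinearMap.range (((transitionFst c c' (c.jetChart θ)).prod
        (transitionSnd c c' (c.jetChart θ)) : Rn n →L[ℝ] Rn n × Rn m) :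
          Rn n →ₗ[ℝ] Rn n × Rn m) := by
  have h1 := c.map_diff_plane hθ
  have h2 : (c'.diff θ.pt : TangentSpace 𝓘(ℝ, Rn (n + m)) θ.pt →ₗ[ℝ] Rn n × Rn m) =
      (fderiv ℝ (transitionMap c c') (c.coord θ.pt) : Rn n × Rn m →ₗ[ℝ] Rn n × Rn m) ∘ₗ
        (c.diff θ.pt : TangentSpace 𝓘(ℝ, Rn (n + m)) θ.pt →ₗ[ℝ] Rn n × Rn m) := by
    ext1 v
    exact diff_eq_comp c c' hθ.1 hp' v
  rw [h2, Submodule.map_comp, h1, LinearMap.graph_eq_range_prod, ← LinearMap.range_comp]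
  rfl

theorem range_prod_eq_graph {P : Rn n →L[ℝ] Rn n} {Q B : Rn n →L[ℝ] Rn m}
    (h : LinearMap.range ((P.prod Q : Rn n →L[ℝ] Rn n × Rn m) : Rn n →ₗ[ℝ] Rn n × Rn m) =
      (B : Rn n →ₗ[ℝ] Rn m).graph) : IsUnit P := by
  have hs : Function.Surjective P := by
    intro y
    have : (y, B y) ∈ (B : Rn n →ₗ[ℝ] Rn m).graph := by simp [LinearMap.mem_graph_iff]
    rw [← h] at this
    obtain ⟨x, hx⟩ := this
    exact ⟨x, (Prod.ext_iff.1 hx).1⟩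
  have hi : Function.Injective P := by
    exact (LinearMap.injective_iff_surjective (f := (P : Rn n →ₗ[ℝ] Rn n))).2 hs
  let e := (LinearEquiv.ofBijective (P : Rn n →ₗ[ℝ] Rn n) ⟨hi, hs⟩).toContinuousLinearEquiv
  exact ⟨ContinuousLinearEquiv.toUnit e, by ext1 x; rfl⟩

theorem range_prod_of_isUnit {P : Rn n →L[ℝ] Rn n} (Q : Rn n →L[ℝ] Rn m) (h : IsUnit P) :
    LinearMap.range ((P.prod Q : Rn n →L[ℝ] Rn n × Rn m) : Rn n →ₗ[ℝ] Rn n × Rn m) =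
      ((Q.comp (Ring.inverse P) : Rn n →L[ℝ] Rn m) : Rn n →ₗ[ℝ] Rn m).graph := by
  have h1 : ∀ x, P (Ring.inverse P x) = x := fun x =>
    DFunLike.congr_fun (Ring.mul_inverse_cancel P h) x
  have h2 : ∀ x, Ring.inverse P (P x) = x := fun x =>
    DFunLike.congr_fun (Ring.inverse_mul_cancel P h) x
  ext ⟨a, b⟩
  simp only [LinearMap.mem_graph_iff, LinearMap.mem_range]
  constructor
  · rintro ⟨x, hx⟩
    obtain ⟨rfl, rfl⟩ := Prod.ext_iff.1 hx
    simp [h2]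
  · intro hb
    refine ⟨Ring.inverse P a, ?_⟩
    ext1
    · exact h1 a
    · exact hb.symm

theorem mem_domain_iff (c c' : DividedChart n m E) {θ : JetSub n m E} (hθ : θ ∈ c.domain)
    (hp' : θ.pt ∈ c'.chart.source) :
    θ ∈ c'.domain ↔ IsUnit (transitionFst c c' (c.jetChart θ)) := by
  constructor
  · rintro ⟨-, B, hB⟩
    rw [map_diff_eq_range c c' hθ hp'] at hB
    exact range_prod_eq_graph hB
  · intro h
    exact ⟨hp', _, (map_diff_eq_range c c' hθ hp').trans (range_prod_of_isUnit _ h)⟩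

theorem jetSlope_eq (c c' : DividedChart n m E) {θ : JetSub n m E} (hθ : θ ∈ c.domain)
    (hθ' : θ ∈ c'.domain) :
    c'.jetSlope θ = (transitionSnd c c' (c.jetChart θ)).comp
      (Ring.inverse (transitionFst c c' (c.jetChart θ))) := by
  rw [DividedChart.jetSlope, map_diff_eq_range c c' hθ hθ'.1,
    range_prod_of_isUnit _ ((mem_domain_iff c c' hθ hθ'.1).1 hθ'), graphSlope_graph]

theorem jetChart_trans_source (c c' : DividedChart n m E) :
    (c.jetChart.symm.trans c'.jetChart).source =
      (transitionSource c c' ×ˢ univ) ∩ transitionFst c c' ⁻¹' {P | IsUnit P} := by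
  ext z
  have key : ∀ hz : z ∈ c.jetChart.target, c.jetChart.symm z ∈ c.domain ∧
      c.jetChart (c.jetChart.symm z) = z ∧
      (c.jetChart.symm z).pt = c.chart.symm (c.split.symm z.1) := fun hz =>
    ⟨c.jetChart.map_target hz, c.jetChart.right_inv hz, JetSub.pt_ofSubmodule _ _⟩
  constructor
  · rintro ⟨hz, hz'⟩
    obtain ⟨h1, h2, h3⟩ := key hz
    have hz'' : c.jetChart.symm z ∈ c'.domain := hz'
    refine ⟨⟨⟨hz, ?_⟩, trivial⟩, ?_⟩
    · change c.chart.symm (c.split.symm z.1) ∈ c'.chart.source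
      rw [← h3]; exact hz''.1
    · have := (mem_domain_iff c c' h1 hz''.1).1 hz''
      rwa [h2] at this
  · rintro ⟨⟨⟨hz, hz'⟩, -⟩, hu⟩
    obtain ⟨h1, h2, h3⟩ := key hz
    refine ⟨hz, ?_⟩
    change c.jetChart.symm z ∈ c'.domain
    rw [mem_domain_iff c c' h1 (by rw [h3]; exact hz'), h2]
    exact hu

theorem jetChart_trans_apply (c c' : DividedChart n m E)
    {z : (Rn n × Rn m) × (Rn n →L[ℝ] Rn m)} (hz : z ∈ (c.jetChart.symm.trans c'.jetChart).source) :
    (c.jetChart.symm.trans c'.jetChart) z = (transitionMap c c' z.1,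
      (transitionSnd c c' z).comp (Ring.inverse (transitionFst c c' z))) := by
  have h1 : c.jetChart.symm z ∈ c.domain := c.jetChart.map_target hz.1
  have h2 : c.jetChart (c.jetChart.symm z) = z := c.jetChart.right_inv hz.1
  have h3 : (c.jetChart.symm z).pt = c.chart.symm (c.split.symm z.1) :=
    JetSub.pt_ofSubmodule _ _
  have h4 := jetSlope_eq c c' h1 hz.2
  rw [h2] at h4
  refine Prod.ext ?_ h4
  change c'.coord (c.jetChart.symm z).pt = _
  rw [h3]; rfl

theorem isOpen_jetChart_trans_source (c c' : DividedChart n m E) :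
    IsOpen (c.jetChart.symm.trans c'.jetChart).source := by
  rw [jetChart_trans_source]
  exact (contDiffOn_transitionFst c c').continuousOn.isOpen_inter_preimage
    ((isOpen_transitionSource c c').prod isOpen_univ) Units.isOpen

theorem contDiffOn_jetChart_trans (c c' : DividedChart n m E) :
    ContDiffOn ℝ ∞ (c.jetChart.symm.trans c'.jetChart)
      (c.jetChart.symm.trans c'.jetChart).source := by
  have hsub : (c.jetChart.symm.trans c'.jetChart).source ⊆ transitionSource c c' ×ˢ univ := by
    rw [jetChart_trans_source]; exact inter_subset_left
  have h : ContDiffOn ℝ ∞ (fun z => (transitionMap c c' z.1,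
      (transitionSnd c c' z).comp (Ring.inverse (transitionFst c c' z))))
      (c.jetChart.symm.trans c'.jetChart).source := by
    refine ContDiffOn.prodMk ?_ ?_
    · exact (contDiffOn_transitionMap c c').comp contDiffOn_fst (fun z hz => (hsub hz).1)
    · refine ((contDiffOn_transitionSnd c c').mono hsub).clm_comp ?_
      intro z hz
      have hu : IsUnit (transitionFst c c' z) := by
        rw [jetChart_trans_source] at hz; exact hz.2
      obtain ⟨u, hu⟩ := hu
      have h3 := contDiffAt_ringInverse ℝ (n := ∞) u
      rw [hu] at h3
      exact h3.comp_contDiffWithinAt z (((contDiffOn_transitionFst c c').mono hsub) z hz)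
  exact h.congr fun z hz => jetChart_trans_apply c c' hz

theorem exists_dividedChart (θ : JetSub n m E) : ∃ c : DividedChart n m E,
    c.chart = chartAt (Rn (n + m)) θ.pt ∧
    θ.plane.map (c.diff θ.pt : TangentSpace 𝓘(ℝ, Rn (n + m)) θ.pt →ₗ[ℝ] Rn n × Rn m) =
      (0 : Rn n →ₗ[ℝ] Rn m).graph := by
  have hp := mem_chart_source (Rn (n + m)) θ.pt
  have h := mdifferentiable_of_mem_atlas (I := 𝓘(ℝ, Rn (n + m)))
    (chart_mem_atlas (Rn (n + m)) θ.pt)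
  have hb := (h.mfderiv hp).bijective
  let T : TangentSpace 𝓘(ℝ, Rn (n + m)) θ.pt →ₗ[ℝ] Rn (n + m) :=
    (mfderiv 𝓘(ℝ, Rn (n + m)) 𝓘(ℝ, Rn (n + m)) (chartAt (Rn (n + m)) θ.pt) θ.pt).toLinearMap
  have hT : Function.Injective T := hb.1
  obtain ⟨L, hL⟩ := exists_splitting (θ.plane.map T)
    ((LinearEquiv.finrank_eq (Submodule.equivMapOfInjective T hT θ.plane)).symm.trans
      θ.finrank_plane)
  refine ⟨⟨chartAt (Rn (n + m)) θ.pt, chart_mem_atlas _ _, L⟩, rfl, ?_⟩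
  rw [← Submodule.map_comp] at hL
  exact hL

/-- A divided chart at `θ = (p, W)`: the preferred chart of `E` at `p`, split in such a way that
`W` becomes `ℝ^n × 0`. -/
def preferredChart (θ : JetSub n m E) : DividedChart n m E := (exists_dividedChart θ).choose

theorem preferredChart_chart (θ : JetSub n m E) :
    (preferredChart θ).chart = chartAt (Rn (n + m)) θ.pt := (exists_dividedChart θ).choose_spec.1

theorem map_preferredChart (θ : JetSub n m E) :
    θ.plane.map ((preferredChart θ).diff θ.pt :
      TangentSpace 𝓘(ℝ, Rn (n + m)) θ.pt →ₗ[ℝ] Rn n × Rn m) =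
      (0 : Rn n →ₗ[ℝ] Rn m).graph := (exists_dividedChart θ).choose_spec.2

theorem mem_preferredChart_domain (θ : JetSub n m E) : θ ∈ (preferredChart θ).domain := by
  refine ⟨?_, 0, map_preferredChart θ⟩
  rw [preferredChart_chart]
  exact mem_chart_source _ _

/-- The atlas of `J¹(E,n)` formed by the charts induced by the divided charts of `E`. -/
def jetCore : ChartedSpaceCore ((Rn n × Rn m) × (Rn n →L[ℝ] Rn m)) (JetSub n m E) where
  atlas := range fun c : DividedChart n m E => c.jetChart
  chartAt θ := (preferredChart θ).jetChart
  mem_chart_source θ := mem_preferredChart_domain θ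
  chart_mem_atlas θ := mem_range_self _
  open_source := by
    rintro _ _ ⟨c, rfl⟩ ⟨c', rfl⟩
    exact isOpen_jetChart_trans_source c c'
  continuousOn_toFun := by
    rintro _ _ ⟨c, rfl⟩ ⟨c', rfl⟩
    exact (contDiffOn_jetChart_trans c c').continuousOn

instance : TopologicalSpace (JetSub n m E) := jetCore.toTopologicalSpace

instance : ChartedSpace ((Rn n × Rn m) × (Rn n →L[ℝ] Rn m)) (JetSub n m E) :=
  jetCore.toChartedSpace

/-- The chart of `J¹(E,n)` induced by a divided chart, as a homeomorphism. -/
def DividedChart.jetHomeo (c : DividedChart n m E) :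
    OpenPartialHomeomorph (JetSub n m E) ((Rn n × Rn m) × (Rn n →L[ℝ] Rn m)) :=
  jetCore.openPartialHomeomorph c.jetChart (mem_range_self c)

theorem mem_atlas_jetSub_iff
    {e : OpenPartialHomeomorph (JetSub n m E) ((Rn n × Rn m) × (Rn n →L[ℝ] Rn m))} :
    e ∈ atlas ((Rn n × Rn m) × (Rn n →L[ℝ] Rn m)) (JetSub n m E) ↔
      ∃ c : DividedChart n m E, e = c.jetHomeo := by
  change e ∈ ⋃ (e : PartialEquiv (JetSub n m E) ((Rn n × Rn m) × (Rn n →L[ℝ] Rn m)))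
    (he : e ∈ jetCore.atlas), {jetCore.openPartialHomeomorph e he} ↔ _
  simp only [mem_iUnion, mem_singleton_iff]
  constructor
  · rintro ⟨_, ⟨c, rfl⟩, h⟩; exact ⟨c, h⟩
  · rintro ⟨c, h⟩; exact ⟨_, mem_range_self c, h⟩

instance : IsManifold 𝓘(ℝ, (Rn n × Rn m) × (Rn n →L[ℝ] Rn m)) ∞ (JetSub n m E) := by
  refine isManifold_of_contDiffOn _ _ _ ?_
  intro e e' he he'
  obtain ⟨c, rfl⟩ := mem_atlas_jetSub_iff.1 he
  obtain ⟨c', rfl⟩ := mem_atlas_jetSub_iff.1 he'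
  have h := contDiffOn_jetChart_trans c c'
  simpa using! h

theorem DividedChart.contMDiffOn_jetHomeo (c : DividedChart n m E) :
    ContMDiffOn 𝓘(ℝ, (Rn n × Rn m) × (Rn n →L[ℝ] Rn m))
      𝓘(ℝ, (Rn n × Rn m) × (Rn n →L[ℝ] Rn m)) ∞ c.jetHomeo c.domain :=
  contMDiffOn_of_mem_maximalAtlas
    (IsManifold.subset_maximalAtlas (mem_atlas_jetSub_iff.2 ⟨c, rfl⟩))

theorem contMDiff_pt : ContMDiff 𝓘(ℝ, (Rn n × Rn m) × (Rn n →L[ℝ] Rn m)) 𝓘(ℝ, Rn (n + m)) ∞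
    (JetSub.pt : JetSub n m E → E) := by
  intro θ
  have hθ := mem_preferredChart_domain θ
  have h1 : ContMDiffAt 𝓘(ℝ, (Rn n × Rn m) × (Rn n →L[ℝ] Rn m))
      𝓘(ℝ, (Rn n × Rn m) × (Rn n →L[ℝ] Rn m)) ∞ (preferredChart θ).jetHomeo θ :=
    (preferredChart θ).contMDiffOn_jetHomeo.contMDiffAt
      ((preferredChart θ).jetHomeo.open_source.mem_nhds hθ)
  have h2 : ContDiff ℝ ∞ (fun z : (Rn n × Rn m) × (Rn n →L[ℝ] Rn m) =>
    (preferredChart θ).split.symm z.1) :=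
    (preferredChart θ).split.symm.contDiff.comp contDiff_fst
  have h3 : ContMDiffAt 𝓘(ℝ, Rn (n + m)) 𝓘(ℝ, Rn (n + m)) ∞ (preferredChart θ).chart.symm
      ((preferredChart θ).chart θ.pt) :=
    (contMDiffOn_symm_of_mem_maximalAtlas (IsManifold.subset_maximalAtlas
      (preferredChart θ).mem)).contMDiffAt
      ((preferredChart θ).chart.open_target.mem_nhds ((preferredChart θ).chart.map_source hθ.1))
  have h4 := h2.contMDiff.contMDiffAt.comp θ h1
  have h5 := ContMDiffAt.comp_of_eq (x := θ) h3 h4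
    (by exact (preferredChart θ).split.symm_apply_apply _)
  refine h5.congr_of_eventuallyEq ?_
  filter_upwards [(preferredChart θ).jetHomeo.open_source.mem_nhds hθ] with θ' hθ'
  have e : (preferredChart θ).split.symm ((preferredChart θ).coord θ'.pt) =
    (preferredChart θ).chart θ'.pt := (preferredChart θ).split.symm_apply_apply _
  change θ'.pt = (preferredChart θ).chart.symm
    ((preferredChart θ).split.symm ((preferredChart θ).coord θ'.pt))
  rw [e, (preferredChart θ).chart.left_inv hθ'.1]

/-- The projection `π_{1,0} : J¹(E,n) → E`. -/
def jetProj : C^∞⟮𝓘(ℝ, (Rn n × Rn m) × (Rn n →L[ℝ] Rn m)), JetSub n m E;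
    𝓘(ℝ, Rn (n + m)), E⟯ := ⟨JetSub.pt, contMDiff_pt⟩

/-! ### The bundle `H^{1,0}` -/

/-- The fibre of `H^{1,0} = {(θ, v) : v ∈ R_θ}`, where `R_θ ⊂ T_p E` is the plane `θ`. -/
def Horiz (θ : JetSub n m E) : Type := θ.plane

instance (θ : JetSub n m E) : AddCommGroup (Horiz θ) := θ.plane.addCommGroup
instance (θ : JetSub n m E) : Module ℝ (Horiz θ) := inferInstanceAs (Module ℝ θ.plane)
instance (θ : JetSub n m E) : TopologicalSpace (Horiz θ) :=
  inferInstanceAs (TopologicalSpace θ.plane)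
instance (θ : JetSub n m E) : IsTopologicalAddGroup (Horiz θ) :=
  inferInstanceAs (IsTopologicalAddGroup θ.plane)
instance (θ : JetSub n m E) : ContinuousSMul ℝ (Horiz θ) :=
  inferInstanceAs (ContinuousSMul ℝ θ.plane)

/-- The inclusion `H^{1,0}_θ → T_p E`. -/
def Horiz.incl (θ : JetSub n m E) : Horiz θ →L[ℝ] TangentSpace 𝓘(ℝ, Rn (n + m)) θ.pt :=
  θ.plane.subtypeL

/-- The components `du^λ` of a vector of the plane in a divided chart. -/
def DividedChart.horizCoord (c : DividedChart n m E) (θ : JetSub n m E) : Horiz θ →L[ℝ] Rn n :=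
  (ContinuousLinearMap.fst ℝ (Rn n) (Rn m)).comp ((c.diff θ.pt).comp (Horiz.incl θ))

theorem DividedChart.diff_incl (c : DividedChart n m E) {θ : JetSub n m E} (h : θ ∈ c.domain)
    (y : Horiz θ) : c.diff θ.pt (Horiz.incl θ y) = (c.horizCoord θ y, c.jetSlope θ (c.horizCoord θ y)) := by
  have : c.diff θ.pt (Horiz.incl θ y) ∈ (c.jetSlope θ : Rn n →ₗ[ℝ] Rn m).graph := by
    rw [← c.map_diff_plane h]
    exact Submodule.mem_map_of_mem y.2
  rw [LinearMap.mem_graph_iff] at this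
  exact Prod.ext rfl this

theorem DividedChart.horizCoord_bijective (c : DividedChart n m E) {θ : JetSub n m E}
    (h : θ ∈ c.domain) : Function.Bijective (c.horizCoord θ) := by
  constructor
  · intro y y' hy
    have h1 := c.diff_incl h y
    rw [hy, ← c.diff_incl h y'] at h1
    exact Subtype.val_injective ((c.diff_bijective h.1).1 h1)
  · intro z
    have : (z, c.jetSlope θ z) ∈ (c.jetSlope θ : Rn n →ₗ[ℝ] Rn m).graph := by
      simp [LinearMap.mem_graph_iff]
    rw [← c.map_diff_plane h] at this
    obtain ⟨y, hy, hyz⟩ := this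
    exact ⟨⟨y, hy⟩, (Prod.ext_iff.1 hyz).1⟩

/-- The components `du^λ` as an isomorphism. -/
def DividedChart.horizEquiv (c : DividedChart n m E) {θ : JetSub n m E} (h : θ ∈ c.domain) :
    Horiz θ ≃ₗ[ℝ] Rn n :=
  LinearEquiv.ofBijective (c.horizCoord θ : Horiz θ →ₗ[ℝ] Rn n) (c.horizCoord_bijective h)

open Classical in
/-- The local trivialization of `H^{1,0}` given by the components `du^λ` in a divided chart. -/
def DividedChart.horizTriv (c : DividedChart n m E) :
    Pretrivialization (Rn n) (π (Rn n) (Horiz : JetSub n m E → Type)) where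
  toFun w := (w.1, c.horizCoord w.1 w.2)
  invFun z := ⟨z.1, if h : z.1 ∈ c.domain then (c.horizEquiv h).symm z.2 else 0⟩
  source := π (Rn n) (Horiz : JetSub n m E → Type) ⁻¹' c.domain
  target := c.domain ×ˢ univ
  map_source' w hw := ⟨hw, trivial⟩
  map_target' z hz := hz.1
  left_inv' := by
    rintro ⟨θ, y⟩ (h : θ ∈ c.domain)
    simp only [dif_pos h]
    congr 1
    exact (c.horizEquiv h).symm_apply_apply y
  right_inv' := by
    rintro ⟨θ, z⟩ ⟨h, -⟩
    have h : θ ∈ c.domain := h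
    simp only [dif_pos h]
    congr 1
    exact (c.horizEquiv h).apply_symm_apply z
  open_target := c.jetHomeo.open_source.prod isOpen_univ
  baseSet := c.domain
  open_baseSet := c.jetHomeo.open_source
  source_eq := rfl
  target_eq := rfl
  proj_toFun _ _ := rfl

theorem contMDiffOn_horizCoordChange (c c' : DividedChart n m E) :
    ContMDiffOn 𝓘(ℝ, (Rn n × Rn m) × (Rn n →L[ℝ] Rn m)) 𝓘(ℝ, Rn n →L[ℝ] Rn n) ∞
      (fun θ => transitionFst c c' (c.jetChart θ)) (c.domain ∩ c'.domain) := by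
  refine (contDiffOn_transitionFst c c').contMDiffOn.comp
    (c.contMDiffOn_jetHomeo.mono inter_subset_left) ?_
  rintro θ ⟨h, h'⟩
  have hs : c.jetChart.symm (c.jetChart θ) = θ := c.jetChart.left_inv h
  have : c.jetChart θ ∈ (c.jetChart.symm.trans c'.jetChart).source := by
    refine ⟨c.jetChart.map_source h, ?_⟩
    change c.jetChart.symm (c.jetChart θ) ∈ c'.domain
    rwa [hs]
  rw [jetChart_trans_source] at this
  exact this.1

open Classical in
theorem horizCoordChange_apply (c c' : DividedChart n m E) {θ : JetSub n m E}
    (h : θ ∈ c.domain ∩ c'.domain) (v : Rn n) :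
    transitionFst c c' (c.jetChart θ) v = (c'.horizTriv ⟨θ, c.horizTriv.symm θ v⟩).2 := by
  have h1 : c.horizTriv.symm θ v = (c.horizEquiv h.1).symm v := by
    have hs := c.horizTriv.mk_symm (b := θ) h.1 v
    have hs2 : c.horizTriv.toPartialEquiv.symm (θ, v) = ⟨θ, (c.horizEquiv h.1).symm v⟩ := by
      refine Eq.trans (b := (⟨θ, if h : θ ∈ c.domain then (c.horizEquiv h).symm v else 0⟩ :
        TotalSpace (Rn n) (Horiz : JetSub n m E → Type))) rfl ?_
      rw [dif_pos h.1]
    rw [hs2] at hs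
    simpa using hs
  have h2 : c.horizCoord θ ((c.horizEquiv h.1).symm v) = v :=
    (c.horizEquiv h.1).apply_symm_apply v
  rw [h1]
  change _ = (c'.diff θ.pt (Horiz.incl θ ((c.horizEquiv h.1).symm v))).1
  rw [diff_eq_comp c c' h.1.1 h.2.1, c.diff_incl h.1, h2]
  rfl

/-- `H^{1,0}` as a vector bundle over `J¹(E,n)`. -/
def horizPrebundle : VectorPrebundle ℝ (Rn n) (Horiz : JetSub n m E → Type) where
  pretrivializationAtlas := range fun c : DividedChart n m E => c.horizTriv
  pretrivialization_linear' := by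
    rintro _ ⟨c, rfl⟩
    exact ⟨fun θ h => ⟨(c.horizCoord θ).map_add, (c.horizCoord θ).map_smul⟩⟩
  pretrivializationAt θ := (preferredChart θ).horizTriv
  mem_base_pretrivializationAt θ := mem_preferredChart_domain θ
  pretrivialization_mem_atlas θ := mem_range_self _
  exists_coordChange := by
    rintro _ ⟨c, rfl⟩ _ ⟨c', rfl⟩
    refine ⟨fun θ => transitionFst c c' (c.jetChart θ), ?_, ?_⟩
    · exact (contMDiffOn_horizCoordChange c c').continuousOn
    · intro θ h v
      exact horizCoordChange_apply c c' h v
  totalSpaceMk_isInducing θ := by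
    have : FiniteDimensional ℝ (Horiz θ) := (((preferredChart θ).horizEquiv
      (mem_preferredChart_domain θ)).symm).finiteDimensional
    have : T2Space (TangentSpace 𝓘(ℝ, Rn (n + m)) θ.pt) :=
      inferInstanceAs (T2Space (Rn (n + m)))
    have : T2Space (Horiz θ) := inferInstanceAs (T2Space θ.plane)
    have h1 := (((preferredChart θ).horizEquiv
      (mem_preferredChart_domain θ)).toContinuousLinearEquiv).toHomeomorph.isInducing
    exact (isInducing_const_prod (x := θ)).2 h1

instance : TopologicalSpace (TotalSpace (Rn n) (Horiz : JetSub n m E → Type)) :=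
  horizPrebundle.totalSpaceTopology

instance : FiberBundle (Rn n) (Horiz : JetSub n m E → Type) := horizPrebundle.toFiberBundle

instance : VectorBundle ℝ (Rn n) (Horiz : JetSub n m E → Type) := horizPrebundle.toVectorBundle

instance : ContMDiffVectorBundle ∞ (Rn n) (Horiz : JetSub n m E → Type)
    𝓘(ℝ, (Rn n × Rn m) × (Rn n →L[ℝ] Rn m)) := by
  have : horizPrebundle.IsContMDiff (n := ∞) 𝓘(ℝ, (Rn n × Rn m) × (Rn n →L[ℝ] Rn m))
      (E := (Horiz : JetSub n m E → Type)) := by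
    refine ⟨?_⟩
    rintro _ ⟨c, rfl⟩ _ ⟨c', rfl⟩
    exact ⟨_, contMDiffOn_horizCoordChange c c', fun θ h v => horizCoordChange_apply c c' h v⟩
  exact horizPrebundle.contMDiffVectorBundle _

end JetSpace

/-! ### Pull-back and homomorphism bundles -/

section PullbackBundle

variable {EB : Type*} [NormedAddCommGroup EB] [NormedSpace ℝ EB]
  {HB : Type*} [TopologicalSpace HB] {I : ModelWithCorners ℝ EB HB}
  {B : Type*} [TopologicalSpace B] [ChartedSpace HB B]
  {EP : Type*} [NormedAddCommGroup EP] [NormedSpace ℝ EP]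
  {HP : Type*} [TopologicalSpace HP] {IP : ModelWithCorners ℝ EP HP}
  {P : Type*} [TopologicalSpace P] [ChartedSpace HP P]
  (f : C^∞⟮IP, P; I, B⟯) (F : Type*) [NormedAddCommGroup F] [NormedSpace ℝ F]
  (V : B → Type*)

/-- The fibre of the pull-back bundle `f^*V`. -/
def PullFibre (p : P) : Type _ := V (f p)

instance [∀ x, AddCommGroup (V x)] (p : P) : AddCommGroup (PullFibre f V p) :=
  inferInstanceAs (AddCommGroup (V (f p)))
instance [∀ x, AddCommGroup (V x)] [∀ x, Module ℝ (V x)] (p : P) : Module ℝ (PullFibre f V p) :=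
  inferInstanceAs (Module ℝ (V (f p)))
instance [∀ x, TopologicalSpace (V x)] (p : P) : TopologicalSpace (PullFibre f V p) :=
  inferInstanceAs (TopologicalSpace (V (f p)))
instance [∀ x, AddCommGroup (V x)] [∀ x, TopologicalSpace (V x)] [∀ x, IsTopologicalAddGroup (V x)]
    (p : P) : IsTopologicalAddGroup (PullFibre f V p) :=
  inferInstanceAs (IsTopologicalAddGroup (V (f p)))
instance [∀ x, AddCommGroup (V x)] [∀ x, Module ℝ (V x)] [∀ x, TopologicalSpace (V x)]
    [∀ x, ContinuousSMul ℝ (V x)] (p : P) : ContinuousSMul ℝ (PullFibre f V p) :=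
  inferInstanceAs (ContinuousSMul ℝ (V (f p)))

variable [TopologicalSpace (TotalSpace F V)]

instance : TopologicalSpace (TotalSpace F (PullFibre f V)) :=
  inferInstanceAs (TopologicalSpace (TotalSpace F ((f : P → B) *ᵖ V)))

variable [∀ x, AddCommGroup (V x)] [∀ x, Module ℝ (V x)] [∀ x, TopologicalSpace (V x)]
  [FiberBundle F V]

instance : FiberBundle F (PullFibre f V) :=
  inferInstanceAs (FiberBundle F ((f : P → B) *ᵖ V))

variable [VectorBundle ℝ F V]

instance : VectorBundle ℝ F (PullFibre f V) :=
  inferInstanceAs (VectorBundle ℝ F ((f : P → B) *ᵖ V))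

instance [ContMDiffVectorBundle ∞ F V I] : ContMDiffVectorBundle ∞ F (PullFibre f V) IP :=
  ContMDiffVectorBundle.pullback F V IP f

theorem PullFibre.symmL_trivializationAt (p : P) (z : F) :
    (trivializationAt F (PullFibre f V) p).symmL ℝ p z =
      (trivializationAt F V (f p)).symmL ℝ (f p) z := by
  have hq : f p ∈ (trivializationAt F V (f p)).baseSet :=
    FiberBundle.mem_baseSet_trivializationAt' (f p)
  have hq' : p ∈ (trivializationAt F (PullFibre f V) p).baseSet := hq
  rw [Trivialization.symmL_apply _ hq, Trivialization.symmL_apply _ hq']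
  apply ((trivializationAt F V (f p)).continuousLinearEquivAt ℝ (f p) hq).injective
  have a1 := (trivializationAt F V (f p)).apply_mk_symm hq z
  have a2 := (trivializationAt F (PullFibre f V) p).apply_mk_symm hq' z
  exact (congrArg Prod.snd a2).trans (congrArg Prod.snd a1).symm

end PullbackBundle

section HomBundle

variable {B : Type*} (F₁ F₂ : Type*) [NormedAddCommGroup F₁] [NormedSpace ℝ F₁]
  [NormedAddCommGroup F₂] [NormedSpace ℝ F₂] (V₁ V₂ : B → Type*)
  [∀ x, AddCommGroup (V₁ x)] [∀ x, Module ℝ (V₁ x)] [∀ x, TopologicalSpace (V₁ x)]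
  [∀ x, AddCommGroup (V₂ x)] [∀ x, Module ℝ (V₂ x)] [∀ x, TopologicalSpace (V₂ x)]

/-- The fibre of the bundle `Hom(V₁, V₂) = V₁^* ⊗ V₂`. -/
def HomFibre (x : B) : Type _ := V₁ x →L[ℝ] V₂ x

variable [∀ x, IsTopologicalAddGroup (V₂ x)] [∀ x, ContinuousSMul ℝ (V₂ x)]

instance (x : B) : AddCommGroup (HomFibre V₁ V₂ x) :=
  inferInstanceAs (AddCommGroup (V₁ x →L[ℝ] V₂ x))
instance (x : B) : Module ℝ (HomFibre V₁ V₂ x) := inferInstanceAs (Module ℝ (V₁ x →L[ℝ] V₂ x))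
instance (x : B) : TopologicalSpace (HomFibre V₁ V₂ x) :=
  inferInstanceAs (TopologicalSpace (V₁ x →L[ℝ] V₂ x))
instance (x : B) : IsTopologicalAddGroup (HomFibre V₁ V₂ x) :=
  inferInstanceAs (IsTopologicalAddGroup (V₁ x →L[ℝ] V₂ x))
instance (x : B) : ContinuousSMul ℝ (HomFibre V₁ V₂ x) :=
  inferInstanceAs (ContinuousSMul ℝ (V₁ x →L[ℝ] V₂ x))

variable [TopologicalSpace B]
  [TopologicalSpace (TotalSpace F₁ V₁)] [FiberBundle F₁ V₁] [VectorBundle ℝ F₁ V₁]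
  [TopologicalSpace (TotalSpace F₂ V₂)] [FiberBundle F₂ V₂] [VectorBundle ℝ F₂ V₂]
  [∀ x, IsTopologicalAddGroup (V₁ x)] [∀ x, ContinuousSMul ℝ (V₁ x)]

instance : TopologicalSpace (TotalSpace (F₁ →L[ℝ] F₂) (HomFibre V₁ V₂)) :=
  inferInstanceAs (TopologicalSpace (TotalSpace (F₁ →L[ℝ] F₂) (fun x => V₁ x →L[ℝ] V₂ x)))
instance : FiberBundle (F₁ →L[ℝ] F₂) (HomFibre V₁ V₂) :=
  inferInstanceAs (FiberBundle (F₁ →L[ℝ] F₂) (fun x => V₁ x →L[ℝ] V₂ x))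
instance : VectorBundle ℝ (F₁ →L[ℝ] F₂) (HomFibre V₁ V₂) :=
  inferInstanceAs (VectorBundle ℝ (F₁ →L[ℝ] F₂) (fun x => V₁ x →L[ℝ] V₂ x))
instance {EB : Type*} [NormedAddCommGroup EB] [NormedSpace ℝ EB]
    {HB : Type*} [TopologicalSpace HB] {I : ModelWithCorners ℝ EB HB} [ChartedSpace HB B]
    [ContMDiffVectorBundle ∞ F₁ V₁ I] [ContMDiffVectorBundle ∞ F₂ V₂ I] :
    ContMDiffVectorBundle ∞ (F₁ →L[ℝ] F₂) (HomFibre V₁ V₂) I :=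
  inferInstanceAs (ContMDiffVectorBundle ∞ (F₁ →L[ℝ] F₂) (fun x => V₁ x →L[ℝ] V₂ x) I)

end HomBundle

/-! ### Linear connections and their vertical projections -/

section Connections

variable {EB : Type*} [NormedAddCommGroup EB] [NormedSpace ℝ EB]
  {HB : Type*} [TopologicalSpace HB] {I : ModelWithCorners ℝ EB HB}
  {B : Type*} [TopologicalSpace B] [ChartedSpace HB B]

/-- The local connection form at `b` of a linear connection, in the preferred local trivialization
at `b`: the linear map `X ↦ X^i Γ_i{}^k{}_j` from `T_b B` to the endomorphisms of the typical
fibre `F`. -/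
abbrev LocalForm (I : ModelWithCorners ℝ EB HB) (F : Type*) [NormedAddCommGroup F]
    [NormedSpace ℝ F] (b : B) : Type _ := TangentSpace I b →ₗ[ℝ] (F →L[ℝ] F)

/-- The local connection forms of the pull-back of a linear connection along `f`. -/
def pullbackForm {F : Type*} [NormedAddCommGroup F] [NormedSpace ℝ F]
    {EP : Type*} [NormedAddCommGroup EP] [NormedSpace ℝ EP]
    {HP : Type*} [TopologicalSpace HP] {IP : ModelWithCorners ℝ EP HP}
    {P : Type*} [TopologicalSpace P] [ChartedSpace HP P] (f : C^∞⟮IP, P; I, B⟯)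
    (A : Π b : B, LocalForm I F b) (p : P) : LocalForm IP F p :=
  A (f p) ∘ₗ (mfderiv IP I f p : TangentSpace IP p →ₗ[ℝ] TangentSpace I (f p))

set_option synthInstance.maxHeartbeats 200000 in
/-- The local connection forms of the linear connection on `V₁^* ⊗ V₂ = Hom(V₁, V₂)` that is the
tensor product of the dual of a connection on `V₁` and of a connection on `V₂`. -/
def homForm {F₁ F₂ : Type*} [NormedAddCommGroup F₁] [NormedSpace ℝ F₁]
    [NormedAddCommGroup F₂] [NormedSpace ℝ F₂]
    (A₁ : Π b : B, LocalForm I F₁ b) (A₂ : Π b : B, LocalForm I F₂ b) (b : B) :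
    LocalForm I (F₁ →L[ℝ] F₂) b :=
  ((ContinuousLinearMap.compL ℝ F₁ F₂ F₂).toLinearMap ∘ₗ A₂ b) -
    ((ContinuousLinearMap.compL ℝ F₁ F₁ F₂).flip.toLinearMap ∘ₗ A₁ b)

variable {F : Type*} [NormedAddCommGroup F] [NormedSpace ℝ F]
  {V : B → Type*} [TopologicalSpace (TotalSpace F V)]
  [∀ x, AddCommGroup (V x)] [∀ x, Module ℝ (V x)] [∀ x, TopologicalSpace (V x)]
  [FiberBundle F V] [VectorBundle ℝ F V]

/-- The section through `f ∈ F` that is constant in the preferred trivialization at `b`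
(extended by zero outside the domain of the trivialization). -/
def constSection (V : B → Type*) [TopologicalSpace (TotalSpace F V)]
    [∀ x, AddCommGroup (V x)] [∀ x, Module ℝ (V x)] [∀ x, TopologicalSpace (V x)]
    [FiberBundle F V] [VectorBundle ℝ F V] (b : B) (f : F) : Π x, V x :=
  fun x => (trivializationAt F V b).symmL ℝ x f

theorem mdifferentiableAt_constSection [ContMDiffVectorBundle ∞ F V I] (b : B) (f : F) :
    MDifferentiableAt I (I.prod 𝓘(ℝ, F))
      (fun x => (⟨x, constSection V b f x⟩ : TotalSpace F V)) b := by
  have h : ContMDiffAt I (I.prod 𝓘(ℝ, F)) ∞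
      (fun x => (⟨x, constSection V b f x⟩ : TotalSpace F V)) b := by
    rw [Bundle.contMDiffAt_section]
    refine (contMDiffAt_const (c := f)).congr_of_eventuallyEq ?_
    filter_upwards [(trivializationAt F V b).open_baseSet.mem_nhds
      (FiberBundle.mem_baseSet_trivializationAt' b)] with x hx
    rw [constSection, Trivialization.symmL_apply _ hx, (trivializationAt F V b).apply_mk_symm hx]
  exact h.mdifferentiableAt (by simp)

section
variable [∀ x, IsTopologicalAddGroup (V x)] [∀ x, ContinuousSMul ℝ (V x)]

/-- The Christoffel symbols of a linear connection: `Γ(X) f = ∇_X s`, read in the preferred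
trivialization at `b`, where `s` is the section constant equal to `f` in that trivialization. -/
def christoffel [ContMDiffVectorBundle ∞ F V I] [FiniteDimensional ℝ F]
    (cov : CovariantDerivative I F V) (b : B) : LocalForm I F b where
  toFun X := LinearMap.toContinuousLinearMap
    { toFun := fun f =>
        (trivializationAt F V b).continuousLinearMapAt ℝ b (cov (constSection V b f) b X)
      map_add' := by
        intro f g
        have h : constSection V b (f + g) = constSection V b f + constSection V b g := by
          ext x; exact map_add _ f g
        rw [h, cov.isCovariantDerivativeOn.add (s := univ) (mdifferentiableAt_constSection b f)
          (mdifferentiableAt_constSection b g)]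
        exact map_add _ _ _
      map_smul' := by
        intro a f
        have h : constSection V b (a • f) = a • constSection V b f := by
          ext x; exact map_smul _ a f
        rw [h, cov.isCovariantDerivativeOn.smul_const (s := univ) a
          (mdifferentiableAt_constSection b f)]
        exact map_smul _ _ _ }
  map_add' X Y := by
    ext f
    simp
  map_smul' a X := by
    ext f
    simp
end

/-- The vertical projection `υ : T_w V → V_b` (`w ∈ V_b`) of the linear connection with local
connection forms `A`; in coordinates, `υ = (dη^k + Γ_i{}^k{}_j η^j du^i) ⊗ p_k`. -/
def verticalProj (A : Π b : B, LocalForm I F b) (w : TotalSpace F V) :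
    TangentSpace (I.prod 𝓘(ℝ, F)) w →ₗ[ℝ] V w.1 :=
  let dη : TangentSpace (I.prod 𝓘(ℝ, F)) w →L[ℝ] F :=
    mfderiv (I.prod 𝓘(ℝ, F)) 𝓘(ℝ, F) (fun w' => (trivializationAt F V w.1 w').2) w
  let dπ : TangentSpace (I.prod 𝓘(ℝ, F)) w →L[ℝ] TangentSpace I w.1 :=
    mfderiv (I.prod 𝓘(ℝ, F)) I (TotalSpace.proj : TotalSpace F V → B) w
  { toFun := fun ξ => (trivializationAt F V w.1).symmL ℝ w.1
      (dη ξ + A w.1 (dπ ξ) (trivializationAt F V w.1 w).2)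
    map_add' := by
      intro ξ ζ
      rw [← map_add]
      congr 1
      simp only [map_add, add_apply]
      abel
    map_smul' := by
      intro a ξ
      rw [RingHom.id_apply, ← map_smul]
      congr 1
      simp only [map_smul, smul_apply, smul_add] }

/-- The natural isomorphism of `V_b` with the vertical subspace of `T_w V`, `w ∈ V_b`: the
differential of the inclusion of the fibre `V_b`, identified with `F` by the preferred
trivialization at `b`. -/
def verticalLift (w : TotalSpace F V) : V w.1 →ₗ[ℝ] TangentSpace (I.prod 𝓘(ℝ, F)) w :=
  let dι : F →L[ℝ] TangentSpace (I.prod 𝓘(ℝ, F)) w :=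
    mfderiv 𝓘(ℝ, F) (I.prod 𝓘(ℝ, F))
      (fun f => (⟨w.1, (trivializationAt F V w.1).symmL ℝ w.1 f⟩ : TotalSpace F V))
      (trivializationAt F V w.1 w).2
  (dι : F →ₗ[ℝ] TangentSpace (I.prod 𝓘(ℝ, F)) w) ∘ₗ
    ((trivializationAt F V w.1).continuousLinearMapAt ℝ w.1 : V w.1 →ₗ[ℝ] F)

theorem mfderiv_proj_verticalLift [ContMDiffVectorBundle ∞ F V I] (w : TotalSpace F V)
    (z : V w.1) :
    mfderiv (I.prod 𝓘(ℝ, F)) I (TotalSpace.proj : TotalSpace F V → B) w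
      (verticalLift (I := I) w z) = 0 := by
  set e := trivializationAt F V w.1
  let g : F → TotalSpace F V := fun f => ⟨w.1, e.symmL ℝ w.1 f⟩
  have key : ∀ (f₀ f : F) (w' : TotalSpace F V), g f₀ = w' →
      (mfderiv (I.prod 𝓘(ℝ, F)) I (TotalSpace.proj : TotalSpace F V → B) w' : EB × F →L[ℝ] EB)
        ((mfderiv 𝓘(ℝ, F) (I.prod 𝓘(ℝ, F)) g f₀ : F →L[ℝ] EB × F) f) = 0 := by
    rintro f₀ f _ rfl
    by_cases hg : MDifferentiableAt 𝓘(ℝ, F) (I.prod 𝓘(ℝ, F)) g f₀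
    · have hp : MDifferentiableAt (I.prod 𝓘(ℝ, F)) I (TotalSpace.proj : TotalSpace F V → B)
          (g f₀) := (Bundle.contMDiffAt_proj V (n := ∞)).mdifferentiableAt (by simp)
      have hc := mfderiv_comp f₀ hp hg
      have hconst : (TotalSpace.proj ∘ g : F → B) = fun _ => w.1 := rfl
      rw [hconst, mfderiv_const] at hc
      exact (DFunLike.congr_fun hc f).symm
    · rw [mfderiv_zero_of_not_mdifferentiableAt hg]
      exact map_zero (mfderiv (I.prod 𝓘(ℝ, F)) I (TotalSpace.proj : TotalSpace F V → B) (g f₀))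
  refine key _ _ _ ?_
  have hb : w.1 ∈ e.baseSet := FiberBundle.mem_baseSet_trivializationAt' w.1
  have h2 : (e w).2 = e.continuousLinearMapAt ℝ w.1 w.2 := by
    exact (congrFun (e.coe_linearMapAt_of_mem (R := ℝ) hb) w.2).symm
  change (⟨w.1, e.symmL ℝ w.1 (e w).2⟩ : TotalSpace F V) = w
  rw [h2, e.symmL_continuousLinearMapAt hb]

/-- The vertical projection `υ : T V → ker Tπ ⊂ T V` of the linear connection on `π : V → B` with
local connection forms `A`. -/
def verticalEnd [ContMDiffVectorBundle ∞ F V I] (A : Π b : B, LocalForm I F b)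
    (w : TotalSpace F V) : TangentSpace (I.prod 𝓘(ℝ, F)) w →ₗ[ℝ]
      LinearMap.ker (mfderiv (I.prod 𝓘(ℝ, F)) I (TotalSpace.proj : TotalSpace F V → B) w :
        TangentSpace (I.prod 𝓘(ℝ, F)) w →ₗ[ℝ] TangentSpace I w.1) :=
  (verticalLift w ∘ₗ verticalProj A w).codRestrict _
    fun ξ => mfderiv_proj_verticalLift w (verticalProj A w ξ)

end Connections

/-! ### The connection on `J¹(E,n) → E` -/

section DotConnection

variable {n m : ℕ} {E : Type*} [TopologicalSpace E] [ChartedSpace (Rn (n + m)) E]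
  [IsManifold 𝓘(ℝ, Rn (n + m)) ∞ E]

/-- The fibre of the bundle `T^{1,0} = π_{1,0}^*(TE)`. -/
def TenFibre (θ : JetSub n m E) : Type :=
  PullFibre jetProj (TangentSpace 𝓘(ℝ, Rn (n + m)) : E → Type) θ

instance (θ : JetSub n m E) : AddCommGroup (TenFibre θ) :=
  instAddCommGroupPullFibre _ _ _
instance (θ : JetSub n m E) : Module ℝ (TenFibre θ) :=
  inferInstanceAs (Module ℝ
    (PullFibre jetProj (TangentSpace 𝓘(ℝ, Rn (n + m)) : E → Type) θ))
instance (θ : JetSub n m E) : TopologicalSpace (TenFibre θ) :=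
  inferInstanceAs (TopologicalSpace
    (PullFibre jetProj (TangentSpace 𝓘(ℝ, Rn (n + m)) : E → Type) θ))
instance (θ : JetSub n m E) : IsTopologicalAddGroup (TenFibre θ) :=
  inferInstanceAs (IsTopologicalAddGroup
    (PullFibre jetProj (TangentSpace 𝓘(ℝ, Rn (n + m)) : E → Type) θ))
instance (θ : JetSub n m E) : ContinuousSMul ℝ (TenFibre θ) :=
  inferInstanceAs (ContinuousSMul ℝ
    (PullFibre jetProj (TangentSpace 𝓘(ℝ, Rn (n + m)) : E → Type) θ))
instance : TopologicalSpace <| TotalSpace (Rn (n + m)) (TenFibre : JetSub n m E → Type) :=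
  inferInstanceAs (TopologicalSpace <| TotalSpace (Rn (n + m))
    (PullFibre jetProj (TangentSpace 𝓘(ℝ, Rn (n + m)) : E → Type) : JetSub n m E → Type))
instance : FiberBundle (Rn (n + m)) (TenFibre : JetSub n m E → Type) :=
  inferInstanceAs (FiberBundle (Rn (n + m))
    (PullFibre jetProj (TangentSpace 𝓘(ℝ, Rn (n + m)) : E → Type) : JetSub n m E → Type))
instance : VectorBundle ℝ (Rn (n + m)) (TenFibre : JetSub n m E → Type) :=
  inferInstanceAs (VectorBundle ℝ (Rn (n + m))
    (PullFibre jetProj (TangentSpace 𝓘(ℝ, Rn (n + m)) : E → Type) : JetSub n m E → Type))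
instance : ContMDiffVectorBundle ∞ (Rn (n + m)) (TenFibre : JetSub n m E → Type) 𝓘(ℝ, (Rn n × Rn m) × (Rn n →L[ℝ] Rn m)) :=
  inferInstanceAs (ContMDiffVectorBundle ∞ (Rn (n + m))
    (PullFibre jetProj (TangentSpace 𝓘(ℝ, Rn (n + m)) : E → Type) : JetSub n m E → Type) 𝓘(ℝ, (Rn n × Rn m) × (Rn n →L[ℝ] Rn m)))

/-- The fibre of the bundle `(H^{1,0})^* ⊗ T^{1,0}` over `J¹(E,n)`. -/
def JetHom (θ : JetSub n m E) : Type := HomFibre Horiz TenFibre θ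

instance (θ : JetSub n m E) : AddCommGroup (JetHom θ) :=
  instAddCommGroupHomFibre Horiz TenFibre θ
instance (θ : JetSub n m E) : Module ℝ (JetHom θ) :=
  inferInstanceAs (Module ℝ (HomFibre Horiz TenFibre θ))
instance (θ : JetSub n m E) : TopologicalSpace (JetHom θ) :=
  inferInstanceAs (TopologicalSpace (HomFibre Horiz TenFibre θ))
instance : TopologicalSpace (TotalSpace (Rn n →L[ℝ] Rn (n + m)) (JetHom : JetSub n m E → Type)) :=
  inferInstanceAs (TopologicalSpace (TotalSpace (Rn n →L[ℝ] Rn (n + m))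
    (HomFibre Horiz TenFibre : JetSub n m E → Type)))
instance : FiberBundle (Rn n →L[ℝ] Rn (n + m)) (JetHom : JetSub n m E → Type) :=
  inferInstanceAs (FiberBundle (Rn n →L[ℝ] Rn (n + m))
    (HomFibre Horiz TenFibre : JetSub n m E → Type))
instance : VectorBundle ℝ (Rn n →L[ℝ] Rn (n + m)) (JetHom : JetSub n m E → Type) :=
  inferInstanceAs (VectorBundle ℝ (Rn n →L[ℝ] Rn (n + m))
    (HomFibre Horiz TenFibre : JetSub n m E → Type))
instance : ContMDiffVectorBundle ∞ (Rn n →L[ℝ] Rn (n + m)) (JetHom : JetSub n m E → Type)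
    𝓘(ℝ, (Rn n × Rn m) × (Rn n →L[ℝ] Rn m)) :=
  inferInstanceAs (ContMDiffVectorBundle ∞ (Rn n →L[ℝ] Rn (n + m))
    (HomFibre Horiz TenFibre : JetSub n m E → Type) 𝓘(ℝ, (Rn n × Rn m) × (Rn n →L[ℝ] Rn m)))

/-- The inclusion `D¹ : H^{1,0} → T^{1,0}`, as a section of `(H^{1,0})^* ⊗ T^{1,0}`. -/
def D1 (θ : JetSub n m E) : TotalSpace (Rn n →L[ℝ] Rn (n + m)) (JetHom : JetSub n m E → Type) :=
  ⟨θ, Horiz.incl θ⟩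

/-- The map `id ⊗ ω¹ : (H^{1,0})^* ⊗ T^{1,0} → (H^{1,0})^* ⊗ V^{1,0}`, `V^{1,0} = T^{1,0} / H^{1,0}`,
over a point of `J¹(E,n)`. -/
def idTensorOmega (θ : JetSub n m E) : JetHom θ →ₗ[ℝ]
    (Horiz θ →ₗ[ℝ] TangentSpace 𝓘(ℝ, Rn (n + m)) θ.pt ⧸ θ.plane) where
  toFun Φ := θ.plane.mkQ ∘ₗ
    ((show Horiz θ →L[ℝ] TangentSpace 𝓘(ℝ, Rn (n + m)) θ.pt from Φ) : Horiz θ →ₗ[ℝ] _)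
  map_add' Φ Ψ := by ext y; exact map_add θ.plane.mkQ _ _
  map_smul' a Φ := by ext y; exact map_smul θ.plane.mkQ a _

/-- The tangent map `T_θ D¹` at a point `θ` of `J¹(E,n)`. -/
def tangentD1 (θ : JetSub n m E) :
    TangentSpace 𝓘(ℝ, (Rn n × Rn m) × (Rn n →L[ℝ] Rn m)) θ →ₗ[ℝ]
      TangentSpace (𝓘(ℝ, (Rn n × Rn m) × (Rn n →L[ℝ] Rn m)).prod 𝓘(ℝ, Rn n →L[ℝ] Rn (n + m)))
        (D1 θ) :=
  (mfderiv 𝓘(ℝ, (Rn n × Rn m) × (Rn n →L[ℝ] Rn m))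
    (𝓘(ℝ, (Rn n × Rn m) × (Rn n →L[ℝ] Rn m)).prod 𝓘(ℝ, Rn n →L[ℝ] Rn (n + m))) D1 θ).toLinearMap

/-- The map `v ↦ d/dt D¹(γ(t))` at `t = 0` modulo `H^{1,0}`, where `γ` is a curve with velocity `v`,
and the derivative is taken in the preferred local trivialization at `θ`. -/
def derivD1 (θ : JetSub n m E) : TangentSpace 𝓘(ℝ, (Rn n × Rn m) × (Rn n →L[ℝ] Rn m)) θ →ₗ[ℝ]
    (Horiz θ →ₗ[ℝ] TangentSpace 𝓘(ℝ, Rn (n + m)) θ.pt ⧸ θ.plane) :=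
  idTensorOmega θ ∘ₗ verticalProj (fun _ => 0) (D1 θ) ∘ₗ tangentD1 θ

/-- The vertical subspace `ker T_θ π_{1,0}`. -/
abbrev jetVertical (θ : JetSub n m E) :
    Submodule ℝ (TangentSpace 𝓘(ℝ, (Rn n × Rn m) × (Rn n →L[ℝ] Rn m)) θ) :=
  LinearMap.ker (mfderiv 𝓘(ℝ, (Rn n × Rn m) × (Rn n →L[ℝ] Rn m)) 𝓘(ℝ, Rn (n + m))
    (JetSub.pt : JetSub n m E → E) θ).toLinearMap

theorem hasMFDerivAt_jetChart (θ : JetSub n m E) :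
    HasMFDerivAt 𝓘(ℝ, (Rn n × Rn m) × (Rn n →L[ℝ] Rn m))
      𝓘(ℝ, (Rn n × Rn m) × (Rn n →L[ℝ] Rn m)) (preferredChart θ).jetHomeo θ
      (ContinuousLinearMap.id ℝ ((Rn n × Rn m) × (Rn n →L[ℝ] Rn m))) := by
  have h1 : MDifferentiableAt 𝓘(ℝ, (Rn n × Rn m) × (Rn n →L[ℝ] Rn m))
      𝓘(ℝ, (Rn n × Rn m) × (Rn n →L[ℝ] Rn m)) (preferredChart θ).jetHomeo θ :=
    ((preferredChart θ).contMDiffOn_jetHomeo.contMDiffAt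
      ((preferredChart θ).jetHomeo.open_source.mem_nhds
        (mem_preferredChart_domain θ))).mdifferentiableAt (by simp)
  have h2 := mfderiv_extChartAt_self (I := 𝓘(ℝ, (Rn n × Rn m) × (Rn n →L[ℝ] Rn m))) (x := θ)
  have h3 := h1.hasMFDerivAt
  have h4 : mfderiv 𝓘(ℝ, (Rn n × Rn m) × (Rn n →L[ℝ] Rn m))
      𝓘(ℝ, (Rn n × Rn m) × (Rn n →L[ℝ] Rn m)) (preferredChart θ).jetHomeo θ =
      ContinuousLinearMap.id ℝ ((Rn n × Rn m) × (Rn n →L[ℝ] Rn m)) := h2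
  rw [h4] at h3
  exact h3

theorem DividedChart.hasMFDerivAt_coord (c : DividedChart n m E) {p : E}
    (hp : p ∈ c.chart.source) :
    HasMFDerivAt 𝓘(ℝ, Rn (n + m)) 𝓘(ℝ, Rn n × Rn m) c.coord p (c.diff p) := by
  have h := mdifferentiable_of_mem_atlas (I := 𝓘(ℝ, Rn (n + m))) c.mem
  exact (c.split.hasFDerivAt.hasMFDerivAt).comp p (h.mdifferentiableAt hp).hasMFDerivAt

theorem diff_mfderiv_pt (θ : JetSub n m E)
    (v : TangentSpace 𝓘(ℝ, (Rn n × Rn m) × (Rn n →L[ℝ] Rn m)) θ) :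
    (preferredChart θ).diff θ.pt (mfderiv 𝓘(ℝ, (Rn n × Rn m) × (Rn n →L[ℝ] Rn m))
      𝓘(ℝ, Rn (n + m)) (JetSub.pt : JetSub n m E → E) θ v) =
      (show (Rn n × Rn m) × (Rn n →L[ℝ] Rn m) from v).1 := by
  have h1 := ((preferredChart θ).hasMFDerivAt_coord (mem_preferredChart_domain θ).1).comp θ
    ((contMDiff_pt (n := n) (m := m) (E := E)).mdifferentiable (by simp) θ).hasMFDerivAt
  have h2 := ((ContinuousLinearMap.fst ℝ (Rn n × Rn m)
    (Rn n →L[ℝ] Rn m)).hasFDerivAt.hasMFDerivAt).comp θ (hasMFDerivAt_jetChart θ)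
  exact DFunLike.congr_fun (hasMFDerivAt_unique h1 h2) v

theorem horizTriv_symm_coord (θ : JetSub n m E) {θ' : JetSub n m E}
    (h : θ' ∈ (preferredChart θ).domain) (z : Rn n) :
    (preferredChart θ).horizCoord θ'
      ((trivializationAt (Rn n) (Horiz : JetSub n m E → Type) θ).symmL ℝ θ' z) = z := by
  have hb : θ' ∈ (trivializationAt (Rn n) (Horiz : JetSub n m E → Type) θ).baseSet := h
  have h1 := (trivializationAt (Rn n) (Horiz : JetSub n m E → Type) θ).apply_mk_symm hb z
  rw [Trivialization.symmL_apply _ hb]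
  exact congrArg Prod.snd h1

theorem trivialization_D1 (θ : JetSub n m E) {θ' : JetSub n m E}
    (h : θ' ∈ (preferredChart θ).domain) :
    (trivializationAt (Rn n →L[ℝ] Rn (n + m)) (JetHom : JetSub n m E → Type) θ (D1 θ')).2 =
      ((preferredChart θ).split.symm : Rn n × Rn m →L[ℝ] Rn (n + m)).comp
        ((ContinuousLinearMap.id ℝ (Rn n)).prod ((preferredChart θ).jetSlope θ')) := by
  ext1 z
  have hsrc : θ'.pt ∈ (chartAt (Rn (n + m)) θ.pt).source := by
    rw [← preferredChart_chart]; exact h.1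
  set y := (trivializationAt (Rn n) (Horiz : JetSub n m E → Type) θ).symmL ℝ θ' z with hy
  have h1 := (preferredChart θ).diff_incl h y
  rw [hy, horizTriv_symm_coord θ h, ← hy] at h1
  have h2 : (trivializationAt (Rn n →L[ℝ] Rn (n + m)) (JetHom : JetSub n m E → Type) θ
      (D1 θ')).2 z = (trivializationAt (Rn (n + m))
        (TangentSpace 𝓘(ℝ, Rn (n + m)) : E → Type) θ.pt).continuousLinearMapAt ℝ θ'.pt
          (Horiz.incl θ' y) := rfl
  rw [h2, TangentBundle.continuousLinearMapAt_trivializationAt hsrc]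
  change _ = (preferredChart θ).split.symm (z, (preferredChart θ).jetSlope θ' z)
  rw [← h1]
  change _ = (preferredChart θ).split.symm ((preferredChart θ).split _)
  rw [ContinuousLinearEquiv.symm_apply_apply, preferredChart_chart]
  rfl

/-- The linear map `A ↦ (x ↦ (0, A x))` read in a divided chart. -/
def DividedChart.slopeHom (c : DividedChart n m E) :
    (Rn n × Rn m) × (Rn n →L[ℝ] Rn m) →L[ℝ] (Rn n →L[ℝ] Rn (n + m)) :=
  (ContinuousLinearMap.compL ℝ (Rn n) (Rn m) (Rn (n + m))
    ((c.split.symm : Rn n × Rn m →L[ℝ] Rn (n + m)).comp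
      (ContinuousLinearMap.inr ℝ (Rn n) (Rn m)))).comp
    (ContinuousLinearMap.snd ℝ (Rn n × Rn m) (Rn n →L[ℝ] Rn m))

theorem hasMFDerivAt_trivialization_D1 (θ : JetSub n m E) :
    HasMFDerivAt 𝓘(ℝ, (Rn n × Rn m) × (Rn n →L[ℝ] Rn m)) 𝓘(ℝ, Rn n →L[ℝ] Rn (n + m))
      (fun θ' => (trivializationAt (Rn n →L[ℝ] Rn (n + m)) (JetHom : JetSub n m E → Type) θ
        (D1 θ')).2) θ (preferredChart θ).slopeHom := by
  have h1 : HasFDerivAt (fun z : (Rn n × Rn m) × (Rn n →L[ℝ] Rn m) =>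
      ((preferredChart θ).split.symm : Rn n × Rn m →L[ℝ] Rn (n + m)).comp
        (ContinuousLinearMap.inl ℝ (Rn n) (Rn m)) + (preferredChart θ).slopeHom z)
      (preferredChart θ).slopeHom
      ((preferredChart θ).jetHomeo θ) := (preferredChart θ).slopeHom.hasFDerivAt.const_add _
  have h2 := h1.hasMFDerivAt.comp θ (hasMFDerivAt_jetChart θ)
  refine HasMFDerivAt.congr_of_eventuallyEq h2 ?_
  filter_upwards [(preferredChart θ).jetHomeo.open_source.mem_nhds
    (mem_preferredChart_domain θ)] with θ' hθ'
  rw [trivialization_D1 θ hθ']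
  ext1 z
  change (preferredChart θ).split.symm (z, (preferredChart θ).jetSlope θ' z) =
    (preferredChart θ).split.symm (z, 0) +
      (preferredChart θ).split.symm (0, (preferredChart θ).jetSlope θ' z)
  rw [← map_add, Prod.mk_add_mk, add_zero, zero_add]

theorem mdifferentiableAt_D1 (θ : JetSub n m E) :
    MDifferentiableAt 𝓘(ℝ, (Rn n × Rn m) × (Rn n →L[ℝ] Rn m))
      (𝓘(ℝ, (Rn n × Rn m) × (Rn n →L[ℝ] Rn m)).prod 𝓘(ℝ, Rn n →L[ℝ] Rn (n + m)))
      (D1 : JetSub n m E → _) θ :=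
  (mdifferentiableAt_totalSpace _ _).2 ⟨mdifferentiableAt_id,
    (hasMFDerivAt_trivialization_D1 θ).mdifferentiableAt⟩

theorem mfderiv_trivialization_tangentD1 (θ : JetSub n m E)
    (v : TangentSpace 𝓘(ℝ, (Rn n × Rn m) × (Rn n →L[ℝ] Rn m)) θ) :
    (mfderiv (𝓘(ℝ, (Rn n × Rn m) × (Rn n →L[ℝ] Rn m)).prod 𝓘(ℝ, Rn n →L[ℝ] Rn (n + m)))
      𝓘(ℝ, Rn n →L[ℝ] Rn (n + m)) (fun w' => (trivializationAt (Rn n →L[ℝ] Rn (n + m))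
        (JetHom : JetSub n m E → Type) θ w').2) (D1 θ) (tangentD1 θ v) :
          Rn n →L[ℝ] Rn (n + m)) =
      ((preferredChart θ).split.symm : Rn n × Rn m →L[ℝ] Rn (n + m)).comp
          ((ContinuousLinearMap.inr ℝ (Rn n) (Rn m)).comp
            (show (Rn n × Rn m) × (Rn n →L[ℝ] Rn m) from v).2) := by
  have hη : MDifferentiableAt (𝓘(ℝ, (Rn n × Rn m) × (Rn n →L[ℝ] Rn m)).prod
      𝓘(ℝ, Rn n →L[ℝ] Rn (n + m))) 𝓘(ℝ, Rn n →L[ℝ] Rn (n + m))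
      (fun w' => (trivializationAt (Rn n →L[ℝ] Rn (n + m))
        (JetHom : JetSub n m E → Type) θ w').2) (D1 θ) :=
    ((mdifferentiableAt_totalSpace 𝓘(ℝ, (Rn n × Rn m) × (Rn n →L[ℝ] Rn m))
      (id : TotalSpace (Rn n →L[ℝ] Rn (n + m)) (JetHom : JetSub n m E → Type) → _)
        (x₀ := D1 θ)).1 mdifferentiableAt_id).2
  have h1 := hη.hasMFDerivAt.comp θ (mdifferentiableAt_D1 θ).hasMFDerivAt
  exact DFunLike.congr_fun (hasMFDerivAt_unique h1 (hasMFDerivAt_trivialization_D1 θ)) v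

theorem trivializationAt_jetHom_symmL (θ : JetSub n m E) (Φ : Rn n →L[ℝ] Rn (n + m))
    (y : Horiz θ) :
    (show Horiz θ →L[ℝ] TangentSpace 𝓘(ℝ, Rn (n + m)) θ.pt from
      (trivializationAt (Rn n →L[ℝ] Rn (n + m)) (JetHom : JetSub n m E → Type) θ).symmL ℝ θ Φ) y =
      (trivializationAt (Rn (n + m)) (TangentSpace 𝓘(ℝ, Rn (n + m)) : E → Type) θ.pt).symmL ℝ θ.pt
        (Φ ((preferredChart θ).horizCoord θ y)) := by
  have hb1 : θ ∈ (trivializationAt (Rn n) (Horiz : JetSub n m E → Type) θ).baseSet :=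
    mem_preferredChart_domain θ
  have hb : θ ∈ (trivializationAt (Rn n →L[ℝ] Rn (n + m))
      (JetHom : JetSub n m E → Type) θ).baseSet := FiberBundle.mem_baseSet_trivializationAt' θ
  have h1 := Pretrivialization.continuousLinearMap_symm_apply' (RingHom.id ℝ)
    (trivializationAt (Rn n) (Horiz : JetSub n m E → Type) θ)
    (trivializationAt (Rn (n + m)) (TenFibre : JetSub n m E → Type) θ)
    (b := θ) hb Φ
  have h2 : (trivializationAt (Rn n) (Horiz : JetSub n m E → Type) θ).continuousLinearMapAt ℝ θ y =
      (preferredChart θ).horizCoord θ y :=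
    congrFun ((trivializationAt (Rn n) (Horiz : JetSub n m E → Type) θ).coe_linearMapAt_of_mem
      (R := ℝ) hb1) y
  rw [Trivialization.symmL_apply _ hb, ← h2]
  exact (DFunLike.congr_fun h1 y).trans (PullFibre.symmL_trivializationAt jetProj (Rn (n + m))
    (TangentSpace 𝓘(ℝ, Rn (n + m)) : E → Type) θ _)

/-- In coordinates, the map `derivD1` is `u̇^i_λ ↦ u̇^i_λ du^λ ⊗ ∂_{u^i}`. -/
theorem derivD1_coord (θ : JetSub n m E)
    (v : TangentSpace 𝓘(ℝ, (Rn n × Rn m) × (Rn n →L[ℝ] Rn m)) θ) (y : Horiz θ) :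
    derivD1 θ v y = θ.plane.mkQ ((trivializationAt (Rn (n + m))
      (TangentSpace 𝓘(ℝ, Rn (n + m)) : E → Type) θ.pt).symmL ℝ θ.pt
        ((preferredChart θ).split.symm (0, (show (Rn n × Rn m) × (Rn n →L[ℝ] Rn m) from v).2
          ((preferredChart θ).horizCoord θ y)))) := by
  have h1 := mfderiv_trivialization_tangentD1 θ v
  have h2 := trivializationAt_jetHom_symmL θ
    (((preferredChart θ).split.symm : Rn n × Rn m →L[ℝ] Rn (n + m)).comp
          ((ContinuousLinearMap.inr ℝ (Rn n) (Rn m)).comp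
            (show (Rn n × Rn m) × (Rn n →L[ℝ] Rn m) from v).2)) y
  rw [← h1] at h2
  have h3 : verticalProj (fun _ => 0) (D1 θ) (tangentD1 θ v) =
      (trivializationAt (Rn n →L[ℝ] Rn (n + m)) (JetHom : JetSub n m E → Type) θ).symmL ℝ θ
      (mfderiv (𝓘(ℝ, (Rn n × Rn m) × (Rn n →L[ℝ] Rn m)).prod 𝓘(ℝ, Rn n →L[ℝ] Rn (n + m)))
      𝓘(ℝ, Rn n →L[ℝ] Rn (n + m)) (fun w' => (trivializationAt (Rn n →L[ℝ] Rn (n + m))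
        (JetHom : JetSub n m E → Type) θ w').2) (D1 θ) (tangentD1 θ v) :
          Rn n →L[ℝ] Rn (n + m)) := by
    refine congrArg ((trivializationAt (Rn n →L[ℝ] Rn (n + m))
      (JetHom : JetSub n m E → Type) θ).symmL ℝ θ) (add_zero _)
  refine (congrArg θ.plane.mkQ (Eq.trans ?_ h2)).trans ?_
  · exact congrArg (fun Ψ : JetHom θ => (show Horiz θ →L[ℝ]
      TangentSpace 𝓘(ℝ, Rn (n + m)) θ.pt from Ψ) y) h3
  · rw [h1]; rfl

theorem tangentTriv_symmL_self (p : E) (z : Rn (n + m)) :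
    mfderiv 𝓘(ℝ, Rn (n + m)) 𝓘(ℝ, Rn (n + m)) (chartAt (Rn (n + m)) p) p
      ((trivializationAt (Rn (n + m)) (TangentSpace 𝓘(ℝ, Rn (n + m)) : E → Type) p).symmL ℝ p z) =
      z := by
  have h := TangentBundle.continuousLinearMapAt_trivializationAt (I := 𝓘(ℝ, Rn (n + m)))
    (x₀ := p) (x := p) (mem_chart_source _ p)
  have h2 := (trivializationAt (Rn (n + m)) (TangentSpace 𝓘(ℝ, Rn (n + m)) : E → Type)
    p).continuousLinearMapAt_symmL (R := ℝ) (FiberBundle.mem_baseSet_trivializationAt' p) z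
  rw [h] at h2
  exact h2

/-- The components `du^i` of a vector modulo the plane `θ`. -/
def normalCoord (θ : JetSub n m E) :
    (TangentSpace 𝓘(ℝ, Rn (n + m)) θ.pt ⧸ θ.plane) →ₗ[ℝ] Rn m :=
  θ.plane.liftQ ((LinearMap.snd ℝ (Rn n) (Rn m)) ∘ₗ
    ((preferredChart θ).diff θ.pt :
      TangentSpace 𝓘(ℝ, Rn (n + m)) θ.pt →ₗ[ℝ] Rn n × Rn m)) (by
      intro x hx
      have h : (preferredChart θ).diff θ.pt x ∈ (0 : Rn n →ₗ[ℝ] Rn m).graph := by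
        rw [← map_preferredChart θ]; exact Submodule.mem_map_of_mem hx
      exact h)

theorem normalCoord_injective (θ : JetSub n m E) : Function.Injective (normalCoord θ) := by
  rw [← LinearMap.ker_eq_bot, eq_bot_iff]
  intro q hq
  obtain ⟨x, rfl⟩ := θ.plane.mkQ_surjective q
  have h : (preferredChart θ).diff θ.pt x ∈ (0 : Rn n →ₗ[ℝ] Rn m).graph := hq
  rw [← map_preferredChart θ] at h
  obtain ⟨x', hx', h⟩ := h
  have : x' = x := ((preferredChart θ).diff_bijective (mem_preferredChart_domain θ).1).1 h
  rw [Submodule.mem_bot, Submodule.mkQ_apply, Submodule.Quotient.mk_eq_zero]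
  exact this ▸ hx'

theorem normalCoord_derivD1 (θ : JetSub n m E)
    (v : TangentSpace 𝓘(ℝ, (Rn n × Rn m) × (Rn n →L[ℝ] Rn m)) θ) (y : Horiz θ) :
    normalCoord θ (derivD1 θ v y) = (show (Rn n × Rn m) × (Rn n →L[ℝ] Rn m) from v).2
      ((preferredChart θ).horizCoord θ y) := by
  rw [derivD1_coord]
  set z : Rn (n + m) := (preferredChart θ).split.symm
    (0, (show (Rn n × Rn m) × (Rn n →L[ℝ] Rn m) from v).2 ((preferredChart θ).horizCoord θ y))
    with hz
  have h1 := tangentTriv_symmL_self θ.pt z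
  rw [← preferredChart_chart] at h1
  have h2 := congrArg (fun z => ((preferredChart θ).split z).2) h1
  refine Eq.trans h2 ?_
  simp [hz]

theorem mem_jetVertical_iff (θ : JetSub n m E)
    (v : TangentSpace 𝓘(ℝ, (Rn n × Rn m) × (Rn n →L[ℝ] Rn m)) θ) :
    v ∈ jetVertical θ ↔ (show (Rn n × Rn m) × (Rn n →L[ℝ] Rn m) from v).1 = 0 := by
  have hi := ((preferredChart θ).diff_bijective (mem_preferredChart_domain θ).1).1
  rw [← diff_mfderiv_pt, LinearMap.mem_ker]
  constructor
  · intro h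
    exact (congrArg _ h).trans (map_zero _)
  · intro h
    exact hi (h.trans (map_zero _).symm)

theorem derivD1_bijective (θ : JetSub n m E) :
    Function.Bijective (derivD1 θ ∘ₗ (jetVertical θ).subtype) := by
  have hH := (preferredChart θ).horizCoord_bijective (mem_preferredChart_domain θ)
  constructor
  · rw [← LinearMap.ker_eq_bot, eq_bot_iff]
    rintro ⟨v, hv⟩ hv0
    have hv1 := (mem_jetVertical_iff θ v).1 hv
    have hv2 : (show (Rn n × Rn m) × (Rn n →L[ℝ] Rn m) from v).2 = 0 := by
      ext1 z
      obtain ⟨y, rfl⟩ := hH.2 z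
      rw [← normalCoord_derivD1]
      have : derivD1 θ v = 0 := hv0
      rw [this]
      simp
    rw [Submodule.mem_bot]
    exact Subtype.ext (Prod.ext hv1 hv2)
  · intro Ψ
    let B : Rn n →L[ℝ] Rn m := LinearMap.toContinuousLinearMap (normalCoord θ ∘ₗ Ψ ∘ₗ
      ((preferredChart θ).horizEquiv (mem_preferredChart_domain θ)).symm.toLinearMap)
    let v : TangentSpace 𝓘(ℝ, (Rn n × Rn m) × (Rn n →L[ℝ] Rn m)) θ :=
      ((0, B) : (Rn n × Rn m) × (Rn n →L[ℝ] Rn m))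
    refine ⟨⟨v, (mem_jetVertical_iff θ v).2 rfl⟩, ?_⟩
    ext1 y
    apply normalCoord_injective
    refine (normalCoord_derivD1 θ v y).trans ?_
    change normalCoord θ (Ψ (((preferredChart θ).horizEquiv (mem_preferredChart_domain θ)).symm
      (((preferredChart θ).horizEquiv (mem_preferredChart_domain θ)) y))) = _
    rw [LinearEquiv.symm_apply_apply]

/-- The isomorphism `ker Tπ_{1,0} ≃ (H^{1,0})^* ⊗ V^{1,0}` over a point of `J¹(E,n)`. -/
def jetVerticalEquiv (θ : JetSub n m E) : jetVertical θ ≃ₗ[ℝ]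
    (Horiz θ →ₗ[ℝ] TangentSpace 𝓘(ℝ, Rn (n + m)) θ.pt ⧸ θ.plane) :=
  LinearEquiv.ofBijective _ (derivD1_bijective θ)

/-- The vertical projection `υ : TJ¹(E,n) → ker Tπ_{1,0} ≃ (H^{1,0})^* ⊗ V^{1,0}` of the connection
on `π_{1,0}` associated with a linear connection `Γ` on `TE`: the composition of `TD¹`, of the
vertical projection of the linear connection `Ξ^* ⊗ π_{1,0}^*(Γ)` on `(H^{1,0})^* ⊗ T^{1,0}`, and
of `id ⊗ ω¹`. Here `Ξ^*` is the dual of an auxiliary linear connection `Ξ` on `H^{1,0}`. -/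
def upsilonDot (Γ : CovariantDerivative 𝓘(ℝ, Rn (n + m)) (Rn (n + m))
      (TangentSpace 𝓘(ℝ, Rn (n + m)) : E → Type))
    (Ξ : CovariantDerivative 𝓘(ℝ, (Rn n × Rn m) × (Rn n →L[ℝ] Rn m)) (Rn n)
      (Horiz : JetSub n m E → Type)) (θ : JetSub n m E) :
    TangentSpace 𝓘(ℝ, (Rn n × Rn m) × (Rn n →L[ℝ] Rn m)) θ →ₗ[ℝ] jetVertical θ :=
  (jetVerticalEquiv θ).symm.toLinearMap ∘ₗ idTensorOmega θ ∘ₗ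
    verticalProj (homForm (christoffel Ξ) (pullbackForm jetProj (christoffel Γ))) (D1 θ) ∘ₗ
      tangentD1 θ

end DotConnection

/-! ### First jets of parametrized submanifolds -/

section Parametrized

variable (n m : ℕ) (M E : Type*) [TopologicalSpace M] [ChartedSpace (Rn n) M]
  [IsManifold 𝓘(ℝ, Rn n) ∞ M]
  [TopologicalSpace E] [ChartedSpace (Rn (n + m)) E] [IsManifold 𝓘(ℝ, Rn (n + m)) ∞ E]

/-- The projection `pr_M : M × E → M`. -/
def prM : C^∞⟮𝓘(ℝ, Rn n).prod 𝓘(ℝ, Rn (n + m)), M × E; 𝓘(ℝ, Rn n), M⟯ := ContMDiffMap.fst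

/-- The projection `pr_E : M × E → E`. -/
def prE : C^∞⟮𝓘(ℝ, Rn n).prod 𝓘(ℝ, Rn (n + m)), M × E; 𝓘(ℝ, Rn (n + m)), E⟯ :=
  ContMDiffMap.snd

/-- The fibre `Hom(T_x M, T_p E)` over `(x, p)` of the bundle
`J¹pr_M = pr_E^*(TE) ⊗ pr_M^*(T^*M) → M × E`; the jet `[s]¹_x` of a map `s : M → E`, regarded as a
section of `pr_M`, is identified with the linear map `T_x s`. -/
def ParJetFibre (z : M × E) : Type :=
  HomFibre (PullFibre (prM n m M E) (TangentSpace 𝓘(ℝ, Rn n) : M → Type))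
    (PullFibre (prE n m M E) (TangentSpace 𝓘(ℝ, Rn (n + m)) : E → Type)) z

instance (z : M × E) : AddCommGroup (ParJetFibre n m M E z) :=
  instAddCommGroupHomFibre (PullFibre (prM n m M E) (TangentSpace 𝓘(ℝ, Rn n) : M → Type))
    (PullFibre (prE n m M E) (TangentSpace 𝓘(ℝ, Rn (n + m)) : E → Type)) z
instance (z : M × E) : Module ℝ (ParJetFibre n m M E z) :=
  inferInstanceAs (Module ℝ (HomFibre
    (PullFibre (prM n m M E) (TangentSpace 𝓘(ℝ, Rn n) : M → Type))
    (PullFibre (prE n m M E) (TangentSpace 𝓘(ℝ, Rn (n + m)) : E → Type)) z))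
instance (z : M × E) : TopologicalSpace (ParJetFibre n m M E z) :=
  inferInstanceAs (TopologicalSpace (HomFibre
    (PullFibre (prM n m M E) (TangentSpace 𝓘(ℝ, Rn n) : M → Type))
    (PullFibre (prE n m M E) (TangentSpace 𝓘(ℝ, Rn (n + m)) : E → Type)) z))
instance : TopologicalSpace <| TotalSpace (Rn n →L[ℝ] Rn (n + m)) (ParJetFibre n m M E) :=
  inferInstanceAs (TopologicalSpace <| TotalSpace (Rn n →L[ℝ] Rn (n + m)) (HomFibre
    (PullFibre (prM n m M E) (TangentSpace 𝓘(ℝ, Rn n) : M → Type))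
    (PullFibre (prE n m M E) (TangentSpace 𝓘(ℝ, Rn (n + m)) : E → Type))))
instance : FiberBundle (Rn n →L[ℝ] Rn (n + m)) (ParJetFibre n m M E) :=
  inferInstanceAs (FiberBundle (Rn n →L[ℝ] Rn (n + m)) (HomFibre
    (PullFibre (prM n m M E) (TangentSpace 𝓘(ℝ, Rn n) : M → Type))
    (PullFibre (prE n m M E) (TangentSpace 𝓘(ℝ, Rn (n + m)) : E → Type))))
instance : VectorBundle ℝ (Rn n →L[ℝ] Rn (n + m)) (ParJetFibre n m M E) :=
  inferInstanceAs (VectorBundle ℝ (Rn n →L[ℝ] Rn (n + m)) (HomFibre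
    (PullFibre (prM n m M E) (TangentSpace 𝓘(ℝ, Rn n) : M → Type))
    (PullFibre (prE n m M E) (TangentSpace 𝓘(ℝ, Rn (n + m)) : E → Type))))
instance : ContMDiffVectorBundle ∞ (Rn n →L[ℝ] Rn (n + m)) (ParJetFibre n m M E) (𝓘(ℝ, Rn n).prod 𝓘(ℝ, Rn (n + m))) :=
  inferInstanceAs (ContMDiffVectorBundle ∞ (Rn n →L[ℝ] Rn (n + m)) (HomFibre
    (PullFibre (prM n m M E) (TangentSpace 𝓘(ℝ, Rn n) : M → Type))
    (PullFibre (prE n m M E) (TangentSpace 𝓘(ℝ, Rn (n + m)) : E → Type))) (𝓘(ℝ, Rn n).prod 𝓘(ℝ, Rn (n + m))))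

/-- The manifold `J¹pr_M`. -/
abbrev ParJet : Type _ := TotalSpace (Rn n →L[ℝ] Rn (n + m)) (ParJetFibre n m M E)

/-- The model with corners of `J¹pr_M`. -/
abbrev ParJetModel (n m : ℕ) :=
  (𝓘(ℝ, Rn n).prod 𝓘(ℝ, Rn (n + m))).prod 𝓘(ℝ, Rn n →L[ℝ] Rn (n + m))

variable {n m M E}

/-- The linear map `T_x s : T_x M → T_p E` of a jet `[s]¹_x`. -/
def ParJet.tangentMap (Φ : ParJet n m M E) :
    TangentSpace 𝓘(ℝ, Rn n) Φ.1.1 →L[ℝ] TangentSpace 𝓘(ℝ, Rn (n + m)) Φ.1.2 := Φ.2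

variable (n m M E) in
/-- The set `Imm J¹pr_M` of the jets of immersions. -/
def immJet : Set (ParJet n m M E) := {Φ | Function.Injective (ParJet.tangentMap Φ)}

/-- The prolongation `pr_E^(1) : Imm J¹pr_M → J¹(E,n)`, `[s]¹_x ↦ [im s]¹_{s(x)}`: the tangent plane
to the image of an immersion `s` is the image of `T_x s`. (Its values outside `Imm J¹pr_M` are
irrelevant.) -/
def prolongE (Φ : ParJet n m M E) : JetSub n m E :=
  JetSub.ofSubmodule Φ.1.2 (LinearMap.range (ParJet.tangentMap Φ).toLinearMap)

/-- The vertical projection `υ : TJ¹pr_M → ker T(pr_M)_{1,0}` of the connection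
`pr_E^*(Γ) ⊗ pr_M^*(Θ^*)`. -/
def upsilonDotPar (Γ : CovariantDerivative 𝓘(ℝ, Rn (n + m)) (Rn (n + m))
      (TangentSpace 𝓘(ℝ, Rn (n + m)) : E → Type))
    (Θ : CovariantDerivative 𝓘(ℝ, Rn n) (Rn n) (TangentSpace 𝓘(ℝ, Rn n) : M → Type))
    (Φ : ParJet n m M E) : TangentSpace (ParJetModel n m) Φ →ₗ[ℝ]
      LinearMap.ker (mfderiv (ParJetModel n m) (𝓘(ℝ, Rn n).prod 𝓘(ℝ, Rn (n + m)))
        (TotalSpace.proj : ParJet n m M E → M × E) Φ).toLinearMap :=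
  verticalEnd (homForm (pullbackForm (prM n m M E) (christoffel Θ))
    (pullbackForm (prE n m M E) (christoffel Γ))) Φ

end Parametrized

end

/-! In a divided chart `(u^λ, u^i)` of `E`, a jet of an immersion is a linear map `A = (A₁, A₂)`
with `A₁` invertible, and its image is the graph of `A₂ A₁⁻¹`. The derivative of `A ↦ A₂ A₁⁻¹` kills
the infinitesimal reparametrizations `A X`, so that the connection form of `Θ` has no effect on the
image, and it sends `G A` to a quantity that depends on the graph only, so that the connection form
`G` of `Γ` descends to `J¹(E,n)`. Likewise `Ξ` drops out of the vertical projection on `J¹(E,n)`: it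
contributes `D¹ ∘ X`, which takes its values in the plane and is killed by `ω¹`. -/

noncomputable section

section ImageSlope

variable {𝕜 X Y : Type*} [NontriviallyNormedField 𝕜]
  [NormedAddCommGroup X] [NormedSpace 𝕜 X] [NormedAddCommGroup Y] [NormedSpace 𝕜 Y]

/-- The slope over `X` of the image of a linear map `A = (A₁, A₂) : X → X × Y` with `A₁`
invertible: this image is the graph of `A₂ ∘ A₁⁻¹`. The junk value is `0` if `A₁` is singular. -/
def imageSlope (A : X →L[𝕜] X × Y) : X →L[𝕜] Y :=
  (.snd 𝕜 X Y ∘L A) ∘L Ring.inverse (.fst 𝕜 X Y ∘L A)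

variable {A : X →L[𝕜] X × Y}

theorem imageSlope_comp_fst (hA : IsUnit (.fst 𝕜 X Y ∘L A)) :
    imageSlope A ∘L (.fst 𝕜 X Y ∘L A) = .snd 𝕜 X Y ∘L A := by
  rw [imageSlope, ContinuousLinearMap.comp_assoc]
  exact congrArg _ (Ring.inverse_mul_cancel _ hA)

theorem comp_inverse_fst (hA : IsUnit (.fst 𝕜 X Y ∘L A)) :
    A ∘L Ring.inverse (.fst 𝕜 X Y ∘L A) = (ContinuousLinearMap.id 𝕜 X).prod (imageSlope A) := by
  ext1 x
  exact Prod.ext (DFunLike.congr_fun (Ring.mul_inverse_cancel _ hA) x) rfl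

theorem contDiffAt_imageSlope [CompleteSpace X] {k : ℕ∞ω} (hA : IsUnit (.fst 𝕜 X Y ∘L A)) :
    ContDiffAt 𝕜 k imageSlope A := by
  obtain ⟨u, hu⟩ := hA
  have hinv := hu ▸ contDiffAt_ringInverse 𝕜 (n := k) u
  exact (contDiff_const.clm_comp contDiff_id).contDiffAt.clm_comp
    (hinv.comp A (contDiff_const.clm_comp contDiff_id).contDiffAt)

theorem fderiv_imageSlope_apply [CompleteSpace X] (hA : IsUnit (.fst 𝕜 X Y ∘L A))
    (B : X →L[𝕜] X × Y) :
    fderiv 𝕜 imageSlope A B =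
      ((.snd 𝕜 X Y - imageSlope A ∘L .fst 𝕜 X Y) ∘L B) ∘L Ring.inverse (.fst 𝕜 X Y ∘L A) := by
  let block₁ := ContinuousLinearMap.compL 𝕜 X (X × Y) X (.fst 𝕜 X Y)
  let block₂ := ContinuousLinearMap.compL 𝕜 X (X × Y) Y (.snd 𝕜 X Y)
  have hslope := ((contDiffAt_imageSlope (k := 1) hA).differentiableAt one_ne_zero).hasFDerivAt
  have hunit : ∀ᶠ A' in 𝓝 A, IsUnit (block₁ A') :=
    block₁.continuous.continuousAt.preimage_mem_nhds (Units.isOpen.mem_nhds hA)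
  have hsnd := block₂.hasFDerivAt (x := A) |>.congr_of_eventuallyEq
    (hunit.mono fun A' hA' => imageSlope_comp_fst hA')
  have leibniz : imageSlope A ∘L (.fst 𝕜 X Y ∘L B) + fderiv 𝕜 imageSlope A B ∘L block₁ A =
      .snd 𝕜 X Y ∘L B :=
    DFunLike.congr_fun ((hslope.clm_comp block₁.hasFDerivAt).unique hsnd) B
  rw [ContinuousLinearMap.sub_comp, ← leibniz, ContinuousLinearMap.comp_assoc (imageSlope A),
    add_sub_cancel_left, ContinuousLinearMap.comp_assoc]
  exact (congrArg (fderiv 𝕜 imageSlope A B ∘L ·) (Ring.mul_inverse_cancel _ hA)).symm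

theorem fderiv_imageSlope_comp_sub_comp [CompleteSpace X] (hA : IsUnit (.fst 𝕜 X Y ∘L A))
    (G : X × Y →L[𝕜] X × Y) (R : X →L[𝕜] X) :
    fderiv 𝕜 imageSlope A (G ∘L A - A ∘L R) =
      (.snd 𝕜 X Y - imageSlope A ∘L .fst 𝕜 X Y) ∘L G ∘L
        (ContinuousLinearMap.id 𝕜 X).prod (imageSlope A) := by
  have reparam : (.snd 𝕜 X Y - imageSlope A ∘L .fst 𝕜 X Y) ∘L A = 0 := by
    rw [ContinuousLinearMap.sub_comp, ContinuousLinearMap.comp_assoc, imageSlope_comp_fst hA,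
      sub_self]
  rw [fderiv_imageSlope_apply hA, ContinuousLinearMap.comp_sub,
    ← ContinuousLinearMap.comp_assoc _ A R, reparam, ContinuousLinearMap.zero_comp, sub_zero,
    ← comp_inverse_fst hA]
  rfl

end ImageSlope

section VerticalInTrivialization

variable {EB : Type*} [NormedAddCommGroup EB] [NormedSpace ℝ EB]
  {HB : Type*} [TopologicalSpace HB] {I : ModelWithCorners ℝ EB HB}
  {B : Type*} [TopologicalSpace B] [ChartedSpace HB B]
  {F : Type*} [NormedAddCommGroup F] [NormedSpace ℝ F]
  {V : B → Type*} [TopologicalSpace (TotalSpace F V)]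
  [∀ x, AddCommGroup (V x)] [∀ x, Module ℝ (V x)] [∀ x, TopologicalSpace (V x)]
  [FiberBundle F V] [VectorBundle ℝ F V]

theorem mdifferentiableAt_trivializationAt_snd [ContMDiffVectorBundle 1 F V I]
    (w : TotalSpace F V) :
    MDifferentiableAt (I.prod 𝓘(ℝ, F)) 𝓘(ℝ, F) (fun w' => (trivializationAt F V w.1 w').2) w :=
  ((mdifferentiableAt_totalSpace I (id : TotalSpace F V → TotalSpace F V)).1
    mdifferentiableAt_id).2

theorem mfderiv_trivializationAt_verticalLift [ContMDiffVectorBundle 1 F V I]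
    (w : TotalSpace F V) (z : V w.1) :
    (mfderiv (I.prod 𝓘(ℝ, F)) 𝓘(ℝ, F) (fun w' => (trivializationAt F V w.1 w').2) w
      (verticalLift (I := I) w z) : F) =
      (trivializationAt F V w.1).continuousLinearMapAt ℝ w.1 z := by
  obtain ⟨b, v⟩ := w
  set e := trivializationAt F V b
  have hb : b ∈ e.baseSet := FiberBundle.mem_baseSet_trivializationAt' b
  let fibre : F → TotalSpace F V := fun f => ⟨b, e.symmL ℝ b f⟩
  have coord_fibre : (fun w' => (e w').2) ∘ fibre = id := funext fun f => by
    change (e ⟨b, e.symmL ℝ b f⟩).2 = f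
    rw [Trivialization.symmL_apply _ hb, e.apply_mk_symm hb]
  obtain ⟨f₀, rfl⟩ : ∃ f₀, e.symmL ℝ b f₀ = v := ⟨_, e.symmL_continuousLinearMapAt hb v⟩
  have coord_fibre_self : (e (fibre f₀)).2 = f₀ := congrFun coord_fibre f₀
  have hfibre : MDifferentiableAt 𝓘(ℝ, F) (I.prod 𝓘(ℝ, F)) fibre f₀ :=
    (mdifferentiableAt_totalSpace I fibre).2
      ⟨mdifferentiableAt_const, mdifferentiableAt_id.congr_of_eventuallyEq
        (.of_forall (congrFun coord_fibre))⟩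
  have chain := (mdifferentiableAt_trivializationAt_snd (I := I) (fibre f₀)).hasMFDerivAt.comp f₀
    hfibre.hasMFDerivAt
  rw [coord_fibre] at chain
  change mfderiv (I.prod 𝓘(ℝ, F)) 𝓘(ℝ, F) (fun w' => (e w').2) (fibre f₀)
    (mfderiv 𝓘(ℝ, F) (I.prod 𝓘(ℝ, F)) fibre (e (fibre f₀)).2 (e.continuousLinearMapAt ℝ b z)) = _
  rw [coord_fibre_self]
  exact DFunLike.congr_fun (hasMFDerivAt_unique chain (hasMFDerivAt_id f₀)) _

theorem mfderiv_trivializationAt_verticalEnd [ContMDiffVectorBundle ∞ F V I]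
    (A : Π b : B, LocalForm I F b) (w : TotalSpace F V)
    (ξ : TangentSpace (I.prod 𝓘(ℝ, F)) w) :
    let dη : TangentSpace (I.prod 𝓘(ℝ, F)) w →L[ℝ] F :=
      mfderiv (I.prod 𝓘(ℝ, F)) 𝓘(ℝ, F) (fun w' => (trivializationAt F V w.1 w').2) w
    dη (verticalEnd A w ξ) = dη ξ + A w.1
      (mfderiv (I.prod 𝓘(ℝ, F)) I (TotalSpace.proj : TotalSpace F V → B) w ξ)
        (trivializationAt F V w.1 w).2 :=
  (mfderiv_trivializationAt_verticalLift w (verticalProj A w ξ)).trans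
    ((trivializationAt F V w.1).continuousLinearMapAt_symmL (R := ℝ)
      (FiberBundle.mem_baseSet_trivializationAt' w.1) _)

end VerticalInTrivialization

section Pullback

variable {EB EP : Type*} [NormedAddCommGroup EB] [NormedSpace ℝ EB] [NormedAddCommGroup EP]
  [NormedSpace ℝ EP] {HB HP : Type*} [TopologicalSpace HB] [TopologicalSpace HP]
  {I : ModelWithCorners ℝ EB HB} {J : ModelWithCorners ℝ EP HP}
  {B P : Type*} [TopologicalSpace B] [ChartedSpace HB B] [TopologicalSpace P] [ChartedSpace HP P]
  (f : C^∞⟮J, P; I, B⟯) (F : Type*) [NormedAddCommGroup F] [NormedSpace ℝ F]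
  {V : B → Type*} [TopologicalSpace (TotalSpace F V)]
  [∀ x, AddCommGroup (V x)] [∀ x, Module ℝ (V x)] [∀ x, TopologicalSpace (V x)]
  [FiberBundle F V] [VectorBundle ℝ F V]

theorem PullFibre.continuousLinearMapAt_trivializationAt {p₀ p : P}
    (hp : f p ∈ (trivializationAt F V (f p₀)).baseSet) (v : V (f p)) :
    (trivializationAt F (PullFibre f V) p₀).continuousLinearMapAt ℝ p v =
      (trivializationAt F V (f p₀)).continuousLinearMapAt ℝ (f p) v := by
  have hp' : p ∈ (trivializationAt F (PullFibre f V) p₀).baseSet := hp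
  exact (congrFun (Trivialization.coe_linearMapAt_of_mem (R := ℝ) _ hp') v).trans
    (congrFun (Trivialization.coe_linearMapAt_of_mem (R := ℝ) _ hp) v).symm

end Pullback

/-- The model with corners of `J¹(E,n)`. -/
abbrev JetSubModel (n m : ℕ) := 𝓘(ℝ, (Rn n × Rn m) × (Rn n →L[ℝ] Rn m))

section JetsInCoordinates

variable {n m : ℕ} {M E : Type*} [TopologicalSpace M] [ChartedSpace (Rn n) M]
  [IsManifold 𝓘(ℝ, Rn n) ∞ M]
  [TopologicalSpace E] [ChartedSpace (Rn (n + m)) E] [IsManifold 𝓘(ℝ, Rn (n + m)) ∞ E]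

/-- The fibre coordinates of `Φ` in the preferred trivialization of `J¹pr_M` at the base point
of `Φ₀`. -/
def ParJet.fibreCoord (Φ₀ Φ : ParJet n m M E) : Rn n →L[ℝ] Rn (n + m) :=
  (trivializationAt (Rn n →L[ℝ] Rn (n + m)) (ParJetFibre n m M E) Φ₀.1 Φ).2

/-- The coordinates `∂(u^λ, u^i)/∂x` of a jet `Φ` in a divided chart over the preferred chart of `E`
at the base point of `Φ₀` and in the preferred chart of `M` there. -/
def DividedChart.jacobian (c : DividedChart n m E) (Φ₀ Φ : ParJet n m M E) :
    Rn n →L[ℝ] Rn n × Rn m :=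
  c.split ∘L Φ₀.fibreCoord Φ

theorem ParJet.fibreCoord_mfderiv_chartAt (Φ₀ Φ : ParJet n m M E)
    (hM : Φ.1.1 ∈ (chartAt (Rn n) Φ₀.1.1).source)
    (hE : Φ.1.2 ∈ (chartAt (Rn (n + m)) Φ₀.1.2).source) (v : TangentSpace 𝓘(ℝ, Rn n) Φ.1.1) :
    Φ₀.fibreCoord Φ (mfderiv 𝓘(ℝ, Rn n) 𝓘(ℝ, Rn n) (chartAt (Rn n) Φ₀.1.1) Φ.1.1 v) =
      mfderiv 𝓘(ℝ, Rn (n + m)) 𝓘(ℝ, Rn (n + m)) (chartAt (Rn (n + m)) Φ₀.1.2) Φ.1.2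
        (Φ.tangentMap v) := by
  let eM := trivializationAt (Rn n)
    (PullFibre (prM n m M E) (TangentSpace 𝓘(ℝ, Rn n) : M → Type)) Φ₀.1
  let eE := trivializationAt (Rn (n + m)) (TangentSpace 𝓘(ℝ, Rn (n + m)) : E → Type) Φ₀.1.2
  have dM : eM.continuousLinearMapAt ℝ Φ.1 =
      mfderiv 𝓘(ℝ, Rn n) 𝓘(ℝ, Rn n) (chartAt (Rn n) Φ₀.1.1) Φ.1.1 := by
    ext1 w
    exact (PullFibre.continuousLinearMapAt_trivializationAt (prM n m M E) (Rn n) hM w).trans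
      (DFunLike.congr_fun (TangentBundle.continuousLinearMapAt_trivializationAt hM) w)
  have dE : eE.continuousLinearMapAt ℝ Φ.1.2 =
      mfderiv 𝓘(ℝ, Rn (n + m)) 𝓘(ℝ, Rn (n + m)) (chartAt (Rn (n + m)) Φ₀.1.2) Φ.1.2 :=
    TangentBundle.continuousLinearMapAt_trivializationAt hE
  rw [← dM, ← dE]
  exact congrArg (fun v' => eE.continuousLinearMapAt ℝ Φ.1.2 (Φ.tangentMap v'))
    (eM.symmL_continuousLinearMapAt (R := ℝ) hM v)

theorem DividedChart.jacobian_mfderiv_chartAt {c : DividedChart n m E} {Φ₀ Φ : ParJet n m M E}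
    (hc : c.chart = chartAt (Rn (n + m)) Φ₀.1.2)
    (hM : Φ.1.1 ∈ (chartAt (Rn n) Φ₀.1.1).source) (hE : Φ.1.2 ∈ c.chart.source)
    (v : TangentSpace 𝓘(ℝ, Rn n) Φ.1.1) :
    c.jacobian Φ₀ Φ (mfderiv 𝓘(ℝ, Rn n) 𝓘(ℝ, Rn n) (chartAt (Rn n) Φ₀.1.1) Φ.1.1 v) =
      c.diff Φ.1.2 (Φ.tangentMap v) := by
  rw [DividedChart.diff, hc]
  exact congrArg c.split (Φ₀.fibreCoord_mfderiv_chartAt Φ hM (hc ▸ hE) v)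

theorem DividedChart.map_diff_range_tangentMap {c : DividedChart n m E} {Φ₀ Φ : ParJet n m M E}
    (hc : c.chart = chartAt (Rn (n + m)) Φ₀.1.2)
    (hM : Φ.1.1 ∈ (chartAt (Rn n) Φ₀.1.1).source) (hE : Φ.1.2 ∈ c.chart.source) :
    (LinearMap.range Φ.tangentMap.toLinearMap).map
      (c.diff Φ.1.2 : TangentSpace 𝓘(ℝ, Rn (n + m)) Φ.1.2 →ₗ[ℝ] Rn n × Rn m) =
      LinearMap.range (c.jacobian Φ₀ Φ).toLinearMap := by
  have surj := (mdifferentiable_of_mem_atlas (I := 𝓘(ℝ, Rn n))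
    (chart_mem_atlas _ Φ₀.1.1)).mfderiv_surjective hM
  rw [← LinearMap.range_comp]
  refine Eq.trans (congrArg LinearMap.range ?_)
    (LinearMap.range_comp_of_range_eq_top _ (LinearMap.range_eq_top.2 surj))
  ext1 v
  exact (c.jacobian_mfderiv_chartAt hc hM hE v).symm

theorem mem_immJet_of_isUnit_jacobian {c : DividedChart n m E} {Φ₀ Φ : ParJet n m M E}
    (hc : c.chart = chartAt (Rn (n + m)) Φ₀.1.2)
    (hM : Φ.1.1 ∈ (chartAt (Rn n) Φ₀.1.1).source) (hE : Φ.1.2 ∈ c.chart.source)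
    (hu : IsUnit (.fst ℝ (Rn n) (Rn m) ∘L c.jacobian Φ₀ Φ)) : Φ ∈ immJet n m M E := by
  have inj_chart := (mdifferentiable_of_mem_atlas (I := 𝓘(ℝ, Rn n))
    (chart_mem_atlas _ Φ₀.1.1)).mfderiv_injective hM
  have inj_jacobian : Function.Injective (c.jacobian Φ₀ Φ) :=
    Function.Injective.of_comp (f := Prod.fst) (ContinuousLinearMap.isUnit_iff_bijective.1 hu).1
  have inj := inj_jacobian.comp inj_chart
  have comp_eq : ⇑(c.jacobian Φ₀ Φ) ∘
      (mfderiv 𝓘(ℝ, Rn n) 𝓘(ℝ, Rn n) (chartAt (Rn n) Φ₀.1.1) Φ.1.1) =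
      c.diff Φ.1.2 ∘ Φ.tangentMap := funext (c.jacobian_mfderiv_chartAt hc hM hE)
  rw [comp_eq] at inj
  exact inj.of_comp

omit [IsManifold 𝓘(ℝ, Rn n) ∞ M] [IsManifold 𝓘(ℝ, Rn (n + m)) ∞ E] in
theorem prolongE_of_mem_immJet {Φ : ParJet n m M E} (h : Φ ∈ immJet n m M E) :
    prolongE Φ = ⟨Φ.1.2, LinearMap.range Φ.tangentMap.toLinearMap,
      (LinearMap.finrank_range_of_inj h).trans (finrank_euclideanSpace_fin (𝕜 := ℝ))⟩ :=
  dif_pos _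

omit [IsManifold 𝓘(ℝ, Rn n) ∞ M] in
theorem pt_prolongE (Φ : ParJet n m M E) : (prolongE Φ).pt = Φ.1.2 := JetSub.pt_ofSubmodule _ _

theorem DividedChart.map_diff_plane_prolongE {c : DividedChart n m E} {Φ₀ Φ : ParJet n m M E}
    (hc : c.chart = chartAt (Rn (n + m)) Φ₀.1.2) (hΦ : Φ ∈ immJet n m M E)
    (hM : Φ.1.1 ∈ (chartAt (Rn n) Φ₀.1.1).source) (hE : Φ.1.2 ∈ c.chart.source) :
    (prolongE Φ).plane.map (c.diff (prolongE Φ).pt :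
      TangentSpace 𝓘(ℝ, Rn (n + m)) (prolongE Φ).pt →ₗ[ℝ] Rn n × Rn m) =
      LinearMap.range (c.jacobian Φ₀ Φ).toLinearMap := by
  rw [prolongE_of_mem_immJet hΦ]
  exact c.map_diff_range_tangentMap hc hM hE

theorem range_eq_graph_imageSlope {A : Rn n →L[ℝ] Rn n × Rn m}
    (hA : IsUnit (.fst ℝ (Rn n) (Rn m) ∘L A)) :
    LinearMap.range A.toLinearMap = (imageSlope A).toLinearMap.graph :=
  range_prod_of_isUnit (.snd ℝ (Rn n) (Rn m) ∘L A) hA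

theorem DividedChart.map_diff_plane_prolongE_eq_graph {c : DividedChart n m E}
    {Φ₀ Φ : ParJet n m M E} (hc : c.chart = chartAt (Rn (n + m)) Φ₀.1.2)
    (hM : Φ.1.1 ∈ (chartAt (Rn n) Φ₀.1.1).source) (hE : Φ.1.2 ∈ c.chart.source)
    (hu : IsUnit (.fst ℝ (Rn n) (Rn m) ∘L c.jacobian Φ₀ Φ)) :
    (prolongE Φ).plane.map (c.diff (prolongE Φ).pt :
      TangentSpace 𝓘(ℝ, Rn (n + m)) (prolongE Φ).pt →ₗ[ℝ] Rn n × Rn m) =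
      (imageSlope (c.jacobian Φ₀ Φ)).toLinearMap.graph :=
  (c.map_diff_plane_prolongE hc (mem_immJet_of_isUnit_jacobian hc hM hE hu) hM hE).trans
    (range_eq_graph_imageSlope hu)

theorem DividedChart.prolongE_mem_domain {c : DividedChart n m E} {Φ₀ Φ : ParJet n m M E}
    (hc : c.chart = chartAt (Rn (n + m)) Φ₀.1.2)
    (hM : Φ.1.1 ∈ (chartAt (Rn n) Φ₀.1.1).source) (hE : Φ.1.2 ∈ c.chart.source)
    (hu : IsUnit (.fst ℝ (Rn n) (Rn m) ∘L c.jacobian Φ₀ Φ)) : prolongE Φ ∈ c.domain :=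
  ⟨(pt_prolongE Φ).symm ▸ hE, _, c.map_diff_plane_prolongE_eq_graph hc hM hE hu⟩

theorem DividedChart.jetHomeo_prolongE {c : DividedChart n m E} {Φ₀ Φ : ParJet n m M E}
    (hc : c.chart = chartAt (Rn (n + m)) Φ₀.1.2)
    (hM : Φ.1.1 ∈ (chartAt (Rn n) Φ₀.1.1).source) (hE : Φ.1.2 ∈ c.chart.source)
    (hu : IsUnit (.fst ℝ (Rn n) (Rn m) ∘L c.jacobian Φ₀ Φ)) :
    c.jetHomeo (prolongE Φ) = (c.coord Φ.1.2, imageSlope (c.jacobian Φ₀ Φ)) :=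
  Prod.ext (congrArg c.coord (pt_prolongE Φ))
    ((congrArg graphSlope (c.map_diff_plane_prolongE_eq_graph hc hM hE hu)).trans
      (graphSlope_graph _))

omit [IsManifold 𝓘(ℝ, Rn n) ∞ M] in
theorem preferredChart_prolongE_chart (Φ : ParJet n m M E) :
    (preferredChart (prolongE Φ)).chart = chartAt (Rn (n + m)) Φ.1.2 := by
  rw [preferredChart_chart, pt_prolongE]

theorem isUnit_jacobian_preferredChart {Φ : ParJet n m M E} (h : Φ ∈ immJet n m M E) :
    IsUnit (.fst ℝ (Rn n) (Rn m) ∘L (preferredChart (prolongE Φ)).jacobian Φ Φ) := by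
  have hc := preferredChart_prolongE_chart Φ
  exact range_prod_eq_graph (B := 0)
    (Q := .snd ℝ (Rn n) (Rn m) ∘L (preferredChart (prolongE Φ)).jacobian Φ Φ)
    ((DividedChart.map_diff_plane_prolongE hc h (mem_chart_source _ _)
      (hc ▸ mem_chart_source _ _)).symm.trans (map_preferredChart _))

theorem jetSlope_preferredChart (θ : JetSub n m E) : (preferredChart θ).jetSlope θ = 0 :=
  (congrArg graphSlope (map_preferredChart θ)).trans (graphSlope_graph 0)

theorem imageSlope_jacobian_preferredChart {Φ : ParJet n m M E} (h : Φ ∈ immJet n m M E) :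
    imageSlope ((preferredChart (prolongE Φ)).jacobian Φ Φ) = 0 := by
  have hc := preferredChart_prolongE_chart Φ
  have hcoord := DividedChart.jetHomeo_prolongE hc (mem_chart_source _ _)
    (hc ▸ mem_chart_source _ _) (isUnit_jacobian_preferredChart h)
  exact (congrArg Prod.snd hcoord).symm.trans (jetSlope_preferredChart _)

end JetsInCoordinates

section Prolongation

variable {n m : ℕ} {M E : Type*} [TopologicalSpace M] [ChartedSpace (Rn n) M]
  [IsManifold 𝓘(ℝ, Rn n) ∞ M]
  [TopologicalSpace E] [ChartedSpace (Rn (n + m)) E] [IsManifold 𝓘(ℝ, Rn (n + m)) ∞ E]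

theorem ParJet.contMDiffAt_fibreCoord (Φ : ParJet n m M E) :
    ContMDiffAt (ParJetModel n m) 𝓘(ℝ, Rn n →L[ℝ] Rn (n + m)) ∞ Φ.fibreCoord Φ :=
  ((Bundle.contMDiffAt_totalSpace (n := ∞) (IM := ParJetModel n m)
    (IB := 𝓘(ℝ, Rn n).prod 𝓘(ℝ, Rn (n + m))) (x₀ := Φ)
    (f := (id : ParJet n m M E → ParJet n m M E))).1 contMDiffAt_id).2

/-- The differential at `Φ` of the fibre coordinates of `J¹pr_M`, with values in the vector space
of these coordinates instead of its tangent space. -/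
def ParJet.fibreCoordDeriv (Φ : ParJet n m M E) :
    TangentSpace (ParJetModel n m) Φ →L[ℝ] (Rn n →L[ℝ] Rn (n + m)) :=
  mfderiv (ParJetModel n m) 𝓘(ℝ, Rn n →L[ℝ] Rn (n + m)) Φ.fibreCoord Φ

theorem DividedChart.contMDiffAt_jacobian (c : DividedChart n m E) (Φ : ParJet n m M E) :
    ContMDiffAt (ParJetModel n m) 𝓘(ℝ, Rn n →L[ℝ] Rn n × Rn m) ∞ (c.jacobian Φ) Φ :=
  (ContDiff.clm_comp (contDiff_const (c := (c.split : Rn (n + m) →L[ℝ] Rn n × Rn m)))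
    contDiff_id).contMDiff.contMDiffAt.comp Φ Φ.contMDiffAt_fibreCoord

theorem DividedChart.hasMFDerivAt_jacobian (c : DividedChart n m E) (Φ : ParJet n m M E) :
    HasMFDerivAt (ParJetModel n m) 𝓘(ℝ, Rn n →L[ℝ] Rn n × Rn m) (c.jacobian Φ) Φ
      (.compL ℝ (Rn n) (Rn (n + m)) (Rn n × Rn m) c.split ∘L Φ.fibreCoordDeriv) :=
  (ContinuousLinearMap.compL ℝ (Rn n) (Rn (n + m)) (Rn n × Rn m)
    c.split).hasFDerivAt.hasMFDerivAt.comp Φ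
      (Φ.contMDiffAt_fibreCoord.mdifferentiableAt (by simp)).hasMFDerivAt

theorem ParJet.contMDiff_proj_snd :
    ContMDiff (ParJetModel n m) 𝓘(ℝ, Rn (n + m)) ∞ (fun Φ : ParJet n m M E => Φ.1.2) :=
  contMDiff_snd.comp (Bundle.contMDiff_proj (ParJetFibre n m M E))

theorem eventually_isUnit_fst_comp_jacobian {Φ : ParJet n m M E} {c : DividedChart n m E}
    (hu : IsUnit (.fst ℝ (Rn n) (Rn m) ∘L c.jacobian Φ Φ)) :
    ∀ᶠ Φ' in 𝓝 Φ, IsUnit (.fst ℝ (Rn n) (Rn m) ∘L c.jacobian Φ Φ') :=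
  ((continuous_const.clm_comp continuous_id).continuousAt.comp
    (c.contMDiffAt_jacobian Φ).continuousAt).preimage_mem_nhds (Units.isOpen.mem_nhds hu)

theorem eventually_jetHomeo_prolongE {Φ : ParJet n m M E} {c : DividedChart n m E}
    (hc : c.chart = chartAt (Rn (n + m)) Φ.1.2)
    (hu : IsUnit (.fst ℝ (Rn n) (Rn m) ∘L c.jacobian Φ Φ)) :
    ∀ᶠ Φ' in 𝓝 Φ, prolongE Φ' ∈ c.domain ∧
      c.jetHomeo (prolongE Φ') = (c.coord Φ'.1.2, imageSlope (c.jacobian Φ Φ')) := by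
  have hproj := FiberBundle.continuous_proj (Rn n →L[ℝ] Rn (n + m)) (ParJetFibre n m M E)
  have near_M : ∀ᶠ Φ' : ParJet n m M E in 𝓝 Φ, Φ'.1.1 ∈ (chartAt (Rn n) Φ.1.1).source :=
    (continuous_fst.comp hproj).continuousAt.preimage_mem_nhds (chart_source_mem_nhds _ _)
  have near_E : ∀ᶠ Φ' : ParJet n m M E in 𝓝 Φ, Φ'.1.2 ∈ c.chart.source :=
    (continuous_snd.comp hproj).continuousAt.preimage_mem_nhds (hc ▸ chart_source_mem_nhds _ _)
  filter_upwards [near_M, near_E, eventually_isUnit_fst_comp_jacobian hu] with Φ' hM hE hu'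
  exact ⟨c.prolongE_mem_domain hc hM hE hu', c.jetHomeo_prolongE hc hM hE hu'⟩

theorem DividedChart.contMDiffAt_coord {c : DividedChart n m E} {p : E}
    (hp : p ∈ c.chart.source) : ContMDiffAt 𝓘(ℝ, Rn (n + m)) 𝓘(ℝ, Rn n × Rn m) ∞ c.coord p :=
  c.split.contDiff.contMDiff.contMDiffAt.comp p ((contMDiffOn_of_mem_maximalAtlas
    (IsManifold.subset_maximalAtlas c.mem)).contMDiffAt (c.chart.open_source.mem_nhds hp))

theorem DividedChart.contMDiffAt_jetHomeo_symm {c : DividedChart n m E} {θ : JetSub n m E}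
    (hθ : θ ∈ c.domain) :
    ContMDiffAt (JetSubModel n m) (JetSubModel n m) ∞ c.jetHomeo.symm (c.jetHomeo θ) :=
  (contMDiffOn_symm_of_mem_maximalAtlas (IsManifold.subset_maximalAtlas
    (mem_atlas_jetSub_iff.2 ⟨c, rfl⟩))).contMDiffAt
    (c.jetHomeo.open_target.mem_nhds (c.jetHomeo.map_source hθ))

theorem contMDiffAt_prolongE {Φ : ParJet n m M E} (h : Φ ∈ immJet n m M E) :
    ContMDiffAt (ParJetModel n m) (JetSubModel n m) ∞
      (prolongE : ParJet n m M E → JetSub n m E) Φ := by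
  have hc := preferredChart_prolongE_chart Φ
  have hu := isUnit_jacobian_preferredChart h
  set c := preferredChart (prolongE Φ)
  have near := eventually_jetHomeo_prolongE hc hu
  obtain ⟨mem_domain, coords⟩ := near.self_of_nhds
  have smooth_coords : ContMDiffAt (ParJetModel n m) (JetSubModel n m) ∞
      (fun Φ' => (c.coord Φ'.1.2, imageSlope (c.jacobian Φ Φ'))) Φ :=
    ((c.contMDiffAt_coord (hc ▸ mem_chart_source _ _)).comp Φ
      (ParJet.contMDiff_proj_snd Φ)).prodMk_space
      ((contDiffAt_imageSlope hu).contMDiffAt.comp Φ (c.contMDiffAt_jacobian Φ))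
  refine ((c.contMDiffAt_jetHomeo_symm mem_domain).comp_of_eq smooth_coords
    coords.symm).congr_of_eventuallyEq ?_
  filter_upwards [near] with Φ' hΦ'
  exact ((congrArg c.jetHomeo.symm hΦ'.2).symm.trans (c.jetHomeo.left_inv hΦ'.1)).symm

theorem mfderiv_prolongE_snd {Φ : ParJet n m M E} (h : Φ ∈ immJet n m M E)
    (ξ : TangentSpace (ParJetModel n m) Φ) :
    (mfderiv (ParJetModel n m) (JetSubModel n m) prolongE Φ ξ).2 =
      fderiv ℝ imageSlope ((preferredChart (prolongE Φ)).jacobian Φ Φ)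
        (((preferredChart (prolongE Φ)).split : Rn (n + m) →L[ℝ] Rn n × Rn m) ∘L
          Φ.fibreCoordDeriv ξ) := by
  have hu := isUnit_jacobian_preferredChart h
  have in_chart := ((ContinuousLinearMap.snd ℝ (Rn n × Rn m)
    (Rn n →L[ℝ] Rn m)).hasFDerivAt.hasMFDerivAt.comp _ (hasMFDerivAt_jetChart (prolongE Φ))).comp Φ
    ((contMDiffAt_prolongE h).mdifferentiableAt (by simp)).hasMFDerivAt
  have by_slope :=
    ((contDiffAt_imageSlope (k := 1) hu).differentiableAt one_ne_zero).hasFDerivAt.hasMFDerivAt.comp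
      Φ ((preferredChart (prolongE Φ)).hasMFDerivAt_jacobian Φ)
  have near := eventually_jetHomeo_prolongE (preferredChart_prolongE_chart Φ) hu
  exact DFunLike.congr_fun (hasMFDerivAt_unique in_chart
    (by_slope.congr_of_eventuallyEq (near.mono fun Φ' hΦ' => congrArg Prod.snd hΦ'.2))) ξ

end Prolongation

section PullbackForm

variable {EB EP EQ : Type*} [NormedAddCommGroup EB] [NormedSpace ℝ EB]
  [NormedAddCommGroup EP] [NormedSpace ℝ EP] [NormedAddCommGroup EQ] [NormedSpace ℝ EQ]
  {HB HP HQ : Type*} [TopologicalSpace HB] [TopologicalSpace HP] [TopologicalSpace HQ]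
  {I : ModelWithCorners ℝ EB HB} {J : ModelWithCorners ℝ EP HP} {K : ModelWithCorners ℝ EQ HQ}
  {B P Q : Type*} [TopologicalSpace B] [ChartedSpace HB B] [TopologicalSpace P] [ChartedSpace HP P]
  [TopologicalSpace Q] [ChartedSpace HQ Q] {F : Type*} [NormedAddCommGroup F] [NormedSpace ℝ F]

theorem pullbackForm_mfderiv (f : C^∞⟮J, P; I, B⟯) (A : Π b : B, LocalForm I F b) {g : Q → P}
    {q : Q} (hg : MDifferentiableAt K J g q) (v : TangentSpace K q) :
    pullbackForm f A (g q) (mfderiv K J g q v) =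
      A (f (g q)) (mfderiv K I (fun q' => f (g q')) q v) :=
  congrArg (A (f (g q)))
    (mfderiv_comp_apply q (f.contMDiff.mdifferentiable (by simp) (g q)) hg v).symm

end PullbackForm

section DotConnection

variable {n m : ℕ} {E : Type*} [TopologicalSpace E] [ChartedSpace (Rn (n + m)) E]
  [IsManifold 𝓘(ℝ, Rn (n + m)) ∞ E]

theorem mfderiv_proj_tangentD1 (θ : JetSub n m E) (v : TangentSpace (JetSubModel n m) θ) :
    mfderiv ((JetSubModel n m).prod 𝓘(ℝ, Rn n →L[ℝ] Rn (n + m))) (JetSubModel n m)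
      (TotalSpace.proj :
        TotalSpace (Rn n →L[ℝ] Rn (n + m)) (JetHom : JetSub n m E → Type) → JetSub n m E)
      (D1 θ) (tangentD1 θ v) = v := by
  have chain := ((Bundle.contMDiffAt_proj (n := ∞) (IB := JetSubModel n m)
    (JetHom : JetSub n m E → Type) (p := D1 θ)).mdifferentiableAt (by simp)).hasMFDerivAt.comp θ
    (mdifferentiableAt_D1 θ).hasMFDerivAt
  exact DFunLike.congr_fun (hasMFDerivAt_unique chain (hasMFDerivAt_id θ)) v

theorem trivialization_D1_self (θ : JetSub n m E) :
    (trivializationAt (Rn n →L[ℝ] Rn (n + m)) (JetHom : JetSub n m E → Type) θ (D1 θ)).2 =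
      ((preferredChart θ).split.symm : Rn n × Rn m →L[ℝ] Rn (n + m)) ∘L .inl ℝ (Rn n) (Rn m) := by
  rw [trivialization_D1 θ (mem_preferredChart_domain θ), jetSlope_preferredChart]
  rfl

theorem normalCoord_idTensorOmega_symmL (θ : JetSub n m E) (Ψ : Rn n →L[ℝ] Rn (n + m))
    (y : Horiz θ) :
    normalCoord θ (idTensorOmega θ ((trivializationAt (Rn n →L[ℝ] Rn (n + m))
      (JetHom : JetSub n m E → Type) θ).symmL ℝ θ Ψ) y) =
      ((preferredChart θ).split (Ψ ((preferredChart θ).horizCoord θ y))).2 := by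
  have chart_symm := tangentTriv_symmL_self θ.pt (Ψ ((preferredChart θ).horizCoord θ y))
  rw [← preferredChart_chart] at chart_symm
  exact (congrArg (fun x => ((preferredChart θ).diff θ.pt x).2)
    (trivializationAt_jetHom_symmL θ Ψ y)).trans
    (congrArg (fun z => ((preferredChart θ).split z).2) chart_symm)

theorem snd_eq_of_derivD1_eq {θ : JetSub n m E} {v : TangentSpace (JetSubModel n m) θ}
    {Ψ : Rn n →L[ℝ] Rn (n + m)}
    (h : derivD1 θ v = idTensorOmega θ ((trivializationAt (Rn n →L[ℝ] Rn (n + m))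
      (JetHom : JetSub n m E → Type) θ).symmL ℝ θ Ψ)) :
    v.2 = .snd ℝ (Rn n) (Rn m) ∘L
      ((preferredChart θ).split : Rn (n + m) →L[ℝ] Rn n × Rn m) ∘L Ψ := by
  ext1 z
  obtain ⟨y, rfl⟩ := ((preferredChart θ).horizCoord_bijective (mem_preferredChart_domain θ)).2 z
  rw [← normalCoord_derivD1, h]
  exact normalCoord_idTensorOmega_symmL θ Ψ y

/-- The local connection form of `Γ` at `p`, in the coordinates `(u^λ, u^i)` of a divided chart over
the preferred chart at `p`. -/
def DividedChart.connectionForm (c : DividedChart n m E)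
    (Γ : CovariantDerivative 𝓘(ℝ, Rn (n + m)) (Rn (n + m))
      (TangentSpace 𝓘(ℝ, Rn (n + m)) : E → Type))
    (p : E) (v : TangentSpace 𝓘(ℝ, Rn (n + m)) p) : Rn n × Rn m →L[ℝ] Rn n × Rn m :=
  (c.split : Rn (n + m) →L[ℝ] Rn n × Rn m) ∘L christoffel Γ p v ∘L
    (c.split.symm : Rn n × Rn m →L[ℝ] Rn (n + m))

theorem upsilonDot_snd (Γ : CovariantDerivative 𝓘(ℝ, Rn (n + m)) (Rn (n + m))
      (TangentSpace 𝓘(ℝ, Rn (n + m)) : E → Type))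
    (Ξ : CovariantDerivative (JetSubModel n m) (Rn n) (Horiz : JetSub n m E → Type))
    (θ : JetSub n m E) (v : TangentSpace (JetSubModel n m) θ) :
    (upsilonDot Γ Ξ θ v : TangentSpace (JetSubModel n m) θ).2 = v.2 + .snd ℝ (Rn n) (Rn m) ∘L
      (preferredChart θ).connectionForm Γ θ.pt
        (mfderiv (JetSubModel n m) 𝓘(ℝ, Rn (n + m)) (JetSub.pt : JetSub n m E → E) θ v) ∘L
      .inl ℝ (Rn n) (Rn m) := by
  let N : Rn n →L[ℝ] Rn (n + m) :=
    ((preferredChart θ).split.symm : Rn n × Rn m →L[ℝ] Rn (n + m)) ∘L .inl ℝ (Rn n) (Rn m)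
  have deriv_eq : derivD1 θ (upsilonDot Γ Ξ θ v) = idTensorOmega θ ((trivializationAt
      (Rn n →L[ℝ] Rn (n + m)) (JetHom : JetSub n m E → Type) θ).symmL ℝ θ
      (((preferredChart θ).split.symm : Rn n × Rn m →L[ℝ] Rn (n + m)) ∘L
        (.inr ℝ (Rn n) (Rn m) ∘L v.2) +
      (christoffel Γ θ.pt (mfderiv (JetSubModel n m) 𝓘(ℝ, Rn (n + m))
        (JetSub.pt : JetSub n m E → E) θ v) ∘L N - N ∘L christoffel Ξ θ v))) := by
    refine ((jetVerticalEquiv θ).apply_symm_apply _).trans (congrArg (fun Ψ => idTensorOmega θ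
      ((trivializationAt (Rn n →L[ℝ] Rn (n + m)) (JetHom : JetSub n m E → Type) θ).symmL ℝ θ Ψ))
      (congrArg₂ (· + ·) (mfderiv_trivialization_tangentD1 θ v) ?_))
    rw [mfderiv_proj_tangentD1]
    exact congrArg (homForm (christoffel Ξ) (pullbackForm jetProj (christoffel Γ)) θ v)
      (trivialization_D1_self θ)
  rw [snd_eq_of_derivD1_eq deriv_eq]
  -- The term of `Ξ` vanishes because `N` takes its values in the plane `u^i = 0`.
  ext1 x
  simp [DividedChart.connectionForm, N]

end DotConnection

section ParametrizedConnection

variable {n m : ℕ} {M E : Type*} [TopologicalSpace M] [ChartedSpace (Rn n) M]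
  [IsManifold 𝓘(ℝ, Rn n) ∞ M]
  [TopologicalSpace E] [ChartedSpace (Rn (n + m)) E] [IsManifold 𝓘(ℝ, Rn (n + m)) ∞ E]
  (Γ : CovariantDerivative 𝓘(ℝ, Rn (n + m)) (Rn (n + m))
    (TangentSpace 𝓘(ℝ, Rn (n + m)) : E → Type))
  (Θ : CovariantDerivative 𝓘(ℝ, Rn n) (Rn n) (TangentSpace 𝓘(ℝ, Rn n) : M → Type))

theorem ParJet.mdifferentiableAt_proj (Φ : ParJet n m M E) :
    MDifferentiableAt (ParJetModel n m) (𝓘(ℝ, Rn n).prod 𝓘(ℝ, Rn (n + m)))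
      (TotalSpace.proj : ParJet n m M E → M × E) Φ :=
  (Bundle.contMDiffAt_proj (n := ∞) (ParJetFibre n m M E)).mdifferentiableAt (by simp)

theorem mfderiv_proj_snd_upsilonDotPar (Φ : ParJet n m M E)
    (ξ : TangentSpace (ParJetModel n m) Φ) :
    mfderiv (ParJetModel n m) 𝓘(ℝ, Rn (n + m)) (fun Φ' : ParJet n m M E => Φ'.1.2) Φ
      (upsilonDotPar Γ Θ Φ ξ) = 0 :=
  (mfderiv_comp_apply Φ ((prE n m M E).contMDiff.mdifferentiable (by simp) Φ.1)
    Φ.mdifferentiableAt_proj _).trans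
    ((congrArg _ (LinearMap.mem_ker.1 (upsilonDotPar Γ Θ Φ ξ).2)).trans (map_zero _))

theorem fibreCoordDeriv_upsilonDotPar (Φ : ParJet n m M E)
    (ξ : TangentSpace (ParJetModel n m) Φ) :
    Φ.fibreCoordDeriv (upsilonDotPar Γ Θ Φ ξ) = Φ.fibreCoordDeriv ξ +
      (christoffel Γ Φ.1.2 (mfderiv (ParJetModel n m) 𝓘(ℝ, Rn (n + m))
          (fun Φ' : ParJet n m M E => Φ'.1.2) Φ ξ) ∘L Φ.fibreCoord Φ -
        Φ.fibreCoord Φ ∘L christoffel Θ Φ.1.1 (mfderiv (ParJetModel n m) 𝓘(ℝ, Rn n)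
          (fun Φ' : ParJet n m M E => Φ'.1.1) Φ ξ)) := by
  have hE := pullbackForm_mfderiv (prE n m M E) (christoffel Γ) Φ.mdifferentiableAt_proj ξ
  have hM := pullbackForm_mfderiv (prM n m M E) (christoffel Θ) Φ.mdifferentiableAt_proj ξ
  exact (mfderiv_trivializationAt_verticalEnd _ Φ ξ).trans (congrArg₂ (fun G X =>
    Φ.fibreCoordDeriv ξ + (G ∘L Φ.fibreCoord Φ - Φ.fibreCoord Φ ∘L X)) hE hM)

theorem DividedChart.split_comp_fibreCoordDeriv_upsilonDotPar (c : DividedChart n m E)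
    (Φ : ParJet n m M E) (ξ : TangentSpace (ParJetModel n m) Φ) :
    (c.split : Rn (n + m) →L[ℝ] Rn n × Rn m) ∘L Φ.fibreCoordDeriv (upsilonDotPar Γ Θ Φ ξ) =
      (c.split : Rn (n + m) →L[ℝ] Rn n × Rn m) ∘L Φ.fibreCoordDeriv ξ +
      (c.connectionForm Γ Φ.1.2 (mfderiv (ParJetModel n m) 𝓘(ℝ, Rn (n + m))
          (fun Φ' : ParJet n m M E => Φ'.1.2) Φ ξ) ∘L c.jacobian Φ Φ -
        c.jacobian Φ Φ ∘L christoffel Θ Φ.1.1 (mfderiv (ParJetModel n m) 𝓘(ℝ, Rn n)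
          (fun Φ' : ParJet n m M E => Φ'.1.1) Φ ξ)) := by
  rw [fibreCoordDeriv_upsilonDotPar]
  ext1 x
  simp [DividedChart.connectionForm, DividedChart.jacobian]

end ParametrizedConnection

section Quotient

variable {n m : ℕ} {M E : Type*} [TopologicalSpace M] [ChartedSpace (Rn n) M]
  [IsManifold 𝓘(ℝ, Rn n) ∞ M]
  [TopologicalSpace E] [ChartedSpace (Rn (n + m)) E] [IsManifold 𝓘(ℝ, Rn (n + m)) ∞ E]
  (Γ : CovariantDerivative 𝓘(ℝ, Rn (n + m)) (Rn (n + m))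
    (TangentSpace 𝓘(ℝ, Rn (n + m)) : E → Type))
  (Θ : CovariantDerivative 𝓘(ℝ, Rn n) (Rn n) (TangentSpace 𝓘(ℝ, Rn n) : M → Type))
  {Φ : ParJet n m M E} (h : Φ ∈ immJet n m M E) (ξ : TangentSpace (ParJetModel n m) Φ)

include h

theorem mfderiv_pt_mfderiv_prolongE :
    mfderiv (JetSubModel n m) 𝓘(ℝ, Rn (n + m)) (JetSub.pt : JetSub n m E → E) (prolongE Φ)
        (mfderiv (ParJetModel n m) (JetSubModel n m) prolongE Φ ξ) =
      mfderiv (ParJetModel n m) 𝓘(ℝ, Rn (n + m))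
        (fun Φ' : ParJet n m M E => (prolongE Φ').pt) Φ ξ :=
  (mfderiv_comp_apply Φ (contMDiff_pt.mdifferentiable (by simp) _)
    ((contMDiffAt_prolongE h).mdifferentiableAt (by simp)) ξ).symm

theorem connectionForm_mfderiv_prolongE (c : DividedChart n m E) :
    c.connectionForm Γ (prolongE Φ).pt (mfderiv (JetSubModel n m) 𝓘(ℝ, Rn (n + m))
        (JetSub.pt : JetSub n m E → E) (prolongE Φ)
        (mfderiv (ParJetModel n m) (JetSubModel n m) prolongE Φ ξ)) =
      c.connectionForm Γ Φ.1.2 (mfderiv (ParJetModel n m) 𝓘(ℝ, Rn (n + m))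
        (fun Φ' : ParJet n m M E => Φ'.1.2) Φ ξ) := by
  have base_eq : ∀ f : ParJet n m M E → E, f = (fun Φ' => Φ'.1.2) →
      c.connectionForm Γ (f Φ) (mfderiv (ParJetModel n m) 𝓘(ℝ, Rn (n + m)) f Φ ξ) =
        c.connectionForm Γ Φ.1.2 (mfderiv (ParJetModel n m) 𝓘(ℝ, Rn (n + m))
          (fun Φ' : ParJet n m M E => Φ'.1.2) Φ ξ) := by
    rintro _ rfl
    rfl
  rw [mfderiv_pt_mfderiv_prolongE h]
  exact base_eq (fun Φ' => (prolongE Φ').pt) (funext pt_prolongE)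

theorem mfderiv_prolongE_upsilonDotPar_mem_jetVertical :
    mfderiv (ParJetModel n m) (JetSubModel n m) prolongE Φ (upsilonDotPar Γ Θ Φ ξ) ∈
      jetVertical (prolongE Φ) := by
  have base_deriv_eq_zero : ∀ f : ParJet n m M E → E, f = (fun Φ' => Φ'.1.2) →
      mfderiv (ParJetModel n m) 𝓘(ℝ, Rn (n + m)) f Φ (upsilonDotPar Γ Θ Φ ξ) = 0 := by
    rintro _ rfl
    exact mfderiv_proj_snd_upsilonDotPar Γ Θ Φ ξ
  exact (mfderiv_pt_mfderiv_prolongE h _).trans (base_deriv_eq_zero _ (funext pt_prolongE))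

theorem mfderiv_prolongE_upsilonDotPar_snd
    (Ξ : CovariantDerivative (JetSubModel n m) (Rn n) (Horiz : JetSub n m E → Type)) :
    (mfderiv (ParJetModel n m) (JetSubModel n m) prolongE Φ (upsilonDotPar Γ Θ Φ ξ)).2 =
      (upsilonDot Γ Ξ (prolongE Φ) (mfderiv (ParJetModel n m) (JetSubModel n m) prolongE Φ ξ) :
        TangentSpace (JetSubModel n m) (prolongE Φ)).2 := by
  rw [upsilonDot_snd, mfderiv_prolongE_snd h, mfderiv_prolongE_snd h,
    connectionForm_mfderiv_prolongE Γ h, DividedChart.split_comp_fibreCoordDeriv_upsilonDotPar,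
    map_add, fderiv_imageSlope_comp_sub_comp (isUnit_jacobian_preferredChart h),
    imageSlope_jacobian_preferredChart h, ContinuousLinearMap.zero_comp, sub_zero]
  rfl

end Quotient

end

theorem mainTheorem11_general {n m : ℕ}
    {E : Type*} [TopologicalSpace E] [ChartedSpace (Rn (n + m)) E]
    [IsManifold 𝓘(ℝ, Rn (n + m)) ∞ E]
    {M : Type*} [TopologicalSpace M] [ChartedSpace (Rn n) M] [IsManifold 𝓘(ℝ, Rn n) ∞ M]
    (Γ : CovariantDerivative 𝓘(ℝ, Rn (n + m)) (Rn (n + m))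
      (TangentSpace 𝓘(ℝ, Rn (n + m)) : E → Type))
    (Θ : CovariantDerivative 𝓘(ℝ, Rn n) (Rn n) (TangentSpace 𝓘(ℝ, Rn n) : M → Type))
    (Ξ : CovariantDerivative (JetSubModel n m) (Rn n) (Horiz : JetSub n m E → Type)) :
    ∀ Φ ∈ immJet n m M E,
      ContMDiffAt (ParJetModel n m) (JetSubModel n m) ∞ prolongE Φ ∧
      ∀ ξ : TangentSpace (ParJetModel n m) Φ,
        mfderiv (ParJetModel n m) (JetSubModel n m) prolongE Φ (upsilonDotPar Γ Θ Φ ξ) =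
          upsilonDot Γ Ξ (prolongE Φ)
            (mfderiv (ParJetModel n m) (JetSubModel n m) prolongE Φ ξ) := by
  intro Φ h
  refine ⟨contMDiffAt_prolongE h, fun ξ =>
    Prod.ext ?_ (mfderiv_prolongE_upsilonDotPar_snd Γ Θ h ξ Ξ)⟩
  have left_vertical := (mem_jetVertical_iff _ _).1
    (mfderiv_prolongE_upsilonDotPar_mem_jetVertical Γ Θ h ξ)
  have right_vertical := (mem_jetVertical_iff _ _).1 (upsilonDot Γ Ξ (prolongE Φ)
    (mfderiv (ParJetModel n m) (JetSubModel n m) prolongE Φ ξ)).2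
  exact left_vertical.trans right_vertical.symm

theorem mainTheorem11 {n m : ℕ}
    {E : Type*} [TopologicalSpace E] [ChartedSpace (Rn (n + m)) E]
    [IsManifold 𝓘(ℝ, Rn (n + m)) ∞ E] [T2Space E] [SecondCountableTopology E]
    {M : Type*} [TopologicalSpace M] [ChartedSpace (Rn n) M]
    [IsManifold 𝓘(ℝ, Rn n) ∞ M] [T2Space M] [SecondCountableTopology M]
    (Γ : CovariantDerivative 𝓘(ℝ, Rn (n + m)) (Rn (n + m))
      (TangentSpace 𝓘(ℝ, Rn (n + m)) : E → Type))
    [CovariantDerivative.ContMDiffCovariantDerivative Γ ∞] (hΓ : Γ.torsion = 0)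
    (Θ : CovariantDerivative 𝓘(ℝ, Rn n) (Rn n) (TangentSpace 𝓘(ℝ, Rn n) : M → Type))
    [CovariantDerivative.ContMDiffCovariantDerivative Θ ∞] (hΘ : Θ.torsion = 0)
    (Ξ : CovariantDerivative 𝓘(ℝ, (Rn n × Rn m) × (Rn n →L[ℝ] Rn m)) (Rn n)
      (Horiz : JetSub n m E → Type))
    [CovariantDerivative.ContMDiffCovariantDerivative Ξ ∞] :
    ∀ Φ ∈ immJet n m M E,
      ContMDiffAt (ParJetModel n m) 𝓘(ℝ, (Rn n × Rn m) × (Rn n →L[ℝ] Rn m)) ∞ prolongE Φ ∧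
      ∀ ξ : TangentSpace (ParJetModel n m) Φ,
        mfderiv (ParJetModel n m) 𝓘(ℝ, (Rn n × Rn m) × (Rn n →L[ℝ] Rn m)) prolongE Φ
            (upsilonDotPar Γ Θ Φ ξ) =
          upsilonDot Γ Ξ (prolongE Φ)
            (mfderiv (ParJetModel n m) 𝓘(ℝ, (Rn n × Rn m) × (Rn n →L[ℝ] Rn m)) prolongE Φ ξ) := by
  exact mainTheorem11_general Γ Θ Ξ
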